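/- Let $h:(0,1)\to\mathbb R$ be given by $h(x)=\log x-\log\frac12$ for $x\le\frac12$ and $h(x)=\log\frac12-\log(1-x)$ for $x\ge\frac12$. Let $\mathrm C(\mathrm I)$ be the set of continuous maps $f$ of $[0,1]$ onto itself with $f(0)=0$, $f(1)=1$, $f((0,1))\subset(0,1)$, for which the one-sided derivatives $f'(0),f'(1)$ exist and lie in $(0,\infty)$, with the distance $d_{\mathrm C(\mathrm I)}(f,g)=\sup_{x\in(0,1)}|h(f(x))-h(g(x))|$. Let $\mathrm{RDS}(\mathrm I)$ be the set of triples $f=(f_0,f_1,p_f)\in \mathrm C(\mathrm I)\times \mathrm C(\mathrm I)\times[0,1]$ such that $f_0,f_1$ are homeomorphisms, $f_0(x)<x<f_1(x)$ for all $x\in(0,1)$, $p_f\in(0,1)$, and $p_f\log f_0'(j)+(1-p_f)\log f_1'(j)>0$ for $j\in\{0,1\}$, with the metric $$d_m(f,g)=\max\{d_{\mathrm C(\mathrm I)}(f_0,g_0),\,d_{\mathrm C(\mathrm I)}(f_1,g_1),\,|p_f-p_g|\}.$$ A Borel probability measure $\mu$ on $(0,1)$ is stationary for $f$ if $\mu(A)=p_f\,\mu(f_0^{-1}(A))+(1-p_f)\,\mu(f_1^{-1}(A))$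 for every Borel set $A\subset(0,1)$; when exactly one such $\mu$ exists, it is denoted by $\mu_f$. The support $\operatorname{supp}(\mu)$ is the set of points of $(0,1)$ all of whose open neighbourhoods have positive $\mu$-measure. **Theorem.** The set of systems $f\in\mathrm{RDS}(\mathrm I)$ that have a unique stationary Borel probability measure $\mu_f$ on $(0,1)$ and for which $\operatorname{supp}(\mu_f)$ has Lebesgue measure zero is dense in $\mathrm{RDS}(\mathrm I)$. Consequently, the set of systems $f\in\mathrm{RDS}(\mathrm I)$ that have a unique stationary Borel probability measure $\mu_f$ on $(0,1)$ and for which $\mu_f$ is singular with respect to Lebesgue measure is dense in $\mathrm{RDS}(\mathrm I)$. -/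

import Mathlib

open MeasureTheory Set
open scoped unitInterval

noncomputable section

namespace RandomInterval

/-- The open unit interval `(0, 1)`, as a type. It carries the subspace topology, the Borel
sigma-algebra. -/
abbrev OpenI : Type := Ioo (0 : ℝ) 1

/-- Lebesgue measure on `(0, 1)`: the measure of `A` is the Lebesgue measure of `A` as a subset
of the real line. -/
def leb : Measure OpenI := (volume : Measure ℝ).comap Subtype.val

theorem leb_apply (A : Set OpenI) : leb A = volume (Subtype.val '' A : Set ℝ) :=
  (MeasurableEmbedding.subtype_coe measurableSet_Ioo).comap_apply _ _

/-- The function `h : (0, 1) → ℝ`. -/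
def h (x : OpenI) : ℝ :=
  if (x : ℝ) ≤ 1 / 2 then Real.log x - Real.log (1 / 2)
  else Real.log (1 / 2) - Real.log (1 - x)

theorem h_injective : Function.Injective h := by
  have key : ∀ x y : OpenI, (x : ℝ) ≤ 1 / 2 → ¬ (y : ℝ) ≤ 1 / 2 → h x ≠ h y := by
    intro x y hx hy hxy
    simp only [h, if_pos hx, if_neg hy] at hxy
    have h1 : Real.log x ≤ Real.log (1 / 2) := Real.log_le_log x.2.1 hx
    have h2 : Real.log (1 - y) < Real.log (1 / 2) :=
      Real.log_lt_log (by linarith [y.2.2]) (by linarith)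
    linarith
  intro x y hxy
  by_cases hx : (x : ℝ) ≤ 1 / 2 <;> by_cases hy : (y : ℝ) ≤ 1 / 2
  · simp only [h, if_pos hx, if_pos hy] at hxy
    exact Subtype.ext (Real.log_injOn_pos x.2.1 y.2.1 (by linarith))
  · exact absurd hxy (key x y hx hy)
  · exact absurd hxy.symm (key y x hy hx)
  · simp only [h, if_neg hx, if_neg hy] at hxy
    have := Real.log_injOn_pos (show (0 : ℝ) < 1 - x by linarith [x.2.2])
      (show (0 : ℝ) < 1 - y by linarith [y.2.2]) (by linarith)
    exact Subtype.ext (by linarith)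

/-- A self-map of `[0, 1]` as a real function on the line, constant outside `[0, 1]`. It is only
used to speak of the (one-sided) derivatives at the endpoints, within `[0, 1]`. -/
def realExt (f : C(I, I)) (x : ℝ) : ℝ := f (projIcc 0 1 zero_le_one x)

/-- The derivative at `0` of a self-map of `[0, 1]`. -/
def derivZero (f : C(I, I)) : ℝ := derivWithin (realExt f) (Icc 0 1) 0

/-- The derivative at `1` of a self-map of `[0, 1]`. -/
def derivOne (f : C(I, I)) : ℝ := derivWithin (realExt f) (Icc 0 1) 1

/-- The conditions defining the class `C(I)`. -/
structure IsCI (f : C(I, I)) : Prop where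
  surjective : Function.Surjective f
  map_zero : f 0 = 0
  map_one : f 1 = 1
  mapsTo : ∀ x : I, (x : ℝ) ∈ Ioo (0 : ℝ) 1 → (f x : ℝ) ∈ Ioo (0 : ℝ) 1
  differentiable_zero : DifferentiableWithinAt ℝ (realExt f) (Icc 0 1) 0
  differentiable_one : DifferentiableWithinAt ℝ (realExt f) (Icc 0 1) 1
  derivZero_pos : 0 < derivZero f
  derivOne_pos : 0 < derivOne f

/-- The space `C(I)`. -/
def CI : Type := {f : C(I, I) // IsCI f}

/-- The restriction of an element of `C(I)` to a self-map of `(0, 1)`. -/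
def CI.restrict (f : CI) (x : OpenI) : OpenI :=
  ⟨f.1 ⟨x, Ioo_subset_Icc_self x.2⟩, f.2.mapsTo _ x.2⟩

theorem CI.continuous_restrict (f : CI) : Continuous f.restrict :=
  Continuous.subtype_mk (continuous_subtype_val.comp
    (f.1.continuous.comp (continuous_subtype_val.subtype_mk _))) _

theorem CI.restrict_injective {f g : CI} (hfg : ∀ x, f.restrict x = g.restrict x) : f = g := by
  refine Subtype.ext (ContinuousMap.ext fun x => ?_)
  rcases eq_or_ne x 0 with rfl | h0
  · rw [f.2.map_zero, g.2.map_zero]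
  rcases eq_or_ne x 1 with rfl | h1
  · rw [f.2.map_one, g.2.map_one]
  · have := hfg ⟨x, unitInterval.pos_iff_ne_zero.2 h0, unitInterval.lt_one_iff_ne_one.2 h1⟩
    exact Subtype.ext (congrArg (fun y : OpenI => (y : ℝ)) this)

/-- The distance on `C(I)`: the supremum over `x ∈ (0, 1)` of `d_h (f x, g x)`, where
`d_h (y, z) = |h y - h z|`. It is written with values in `[0, ∞]`. -/
instance : EMetricSpace CI where
  edist f g := ⨆ x : OpenI, ENNReal.ofReal |h (f.restrict x) - h (g.restrict x)|
  edist_self f := by simp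
  edist_comm f g := by simp_rw [abs_sub_comm]
  edist_triangle f g k := by
    refine iSup_le fun x => ?_
    refine le_trans ?_ (add_le_add
      (le_iSup (fun x => ENNReal.ofReal |h (f.restrict x) - h (g.restrict x)|) x)
      (le_iSup (fun x => ENNReal.ofReal |h (g.restrict x) - h (k.restrict x)|) x))
    rw [← ENNReal.ofReal_add (abs_nonneg _) (abs_nonneg _)]
    exact ENNReal.ofReal_le_ofReal (abs_sub_le _ _ _)
  eq_of_edist_eq_zero {f g} hfg := by
    refine CI.restrict_injective fun x => h_injective ?_
    have hx := (iSup_eq_bot.1 hfg) x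
    rw [bot_eq_zero, ENNReal.ofReal_eq_zero] at hx
    exact sub_eq_zero.1 (abs_nonpos_iff.1 hx)

/-- The conditions on a triple `(f₀, f₁, p)` to be a system in `RDS(I)`. -/
structure IsRDS (f : CI × CI × I) : Prop where
  homeo_fst : IsHomeomorph f.1.1
  homeo_snd : IsHomeomorph f.2.1.1
  below : ∀ x : OpenI, f.1.restrict x < x
  above : ∀ x : OpenI, x < f.2.1.restrict x
  prob_mem : (f.2.2 : ℝ) ∈ Ioo (0 : ℝ) 1
  lyapunov_zero : 0 < (f.2.2 : ℝ) * Real.log (derivZero f.1.1)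
    + (1 - (f.2.2 : ℝ)) * Real.log (derivZero f.2.1.1)
  lyapunov_one : 0 < (f.2.2 : ℝ) * Real.log (derivOne f.1.1)
    + (1 - (f.2.2 : ℝ)) * Real.log (derivOne f.2.1.1)

/-- The space `RDS(I)`. As a subtype of the product `C(I) × C(I) × [0, 1]` it carries the
maximum metric of the three factors. -/
abbrev RDS : Type := {f : CI × CI × I // IsRDS f}

/-- The distance on `RDS(I)` unfolds to the maximum of the three distances. -/
theorem RDS.edist_eq (f g : RDS) :
    edist f g = max (⨆ x, ENNReal.ofReal |h (f.1.1.restrict x) - h (g.1.1.restrict x)|)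
      (max (⨆ x, ENNReal.ofReal |h (f.1.2.1.restrict x) - h (g.1.2.1.restrict x)|)
        (ENNReal.ofReal |(f.1.2.2 : ℝ) - g.1.2.2|)) := by
  have : edist f.1.2.2 g.1.2.2 = ENNReal.ofReal |(f.1.2.2 : ℝ) - g.1.2.2| := by
    rw [Subtype.edist_eq, edist_dist, Real.dist_eq]
  rw [← this]
  rfl

/-- The Markov operator `P_f μ = p · (f₀)_* μ + (1 - p) · (f₁)_* μ`. -/
def RDS.markov (f : RDS) (μ : Measure OpenI) : Measure OpenI :=
  ENNReal.ofReal (f.1.2.2 : ℝ) • μ.map f.1.1.restrict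
    + ENNReal.ofReal (1 - (f.1.2.2 : ℝ)) • μ.map f.1.2.1.restrict

/-- `μ` is a stationary measure for `f`. -/
def RDS.IsStationary (f : RDS) (μ : Measure OpenI) : Prop := f.markov μ = μ

/-- `μ` is the stationary measure `μ_f` of `f`: it is the unique stationary Borel probability
measure for `f` on `(0, 1)`. -/
structure RDS.IsTheStationaryMeasure (f : RDS) (μ : Measure OpenI) : Prop where
  isProbabilityMeasure : IsProbabilityMeasure μ
  isStationary : f.IsStationary μ
  unique : ∀ ν : Measure OpenI, IsProbabilityMeasure ν → f.IsStationary ν → ν = μ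

end RandomInterval

end

noncomputable section

namespace RandomInterval

open Filter Topology

/-! In the coordinate `h` the interval `(0, 1)` becomes the line, the distance on `C(I)` becomes the
uniform distance, and an element `f` of `C(I)` becomes a map asymptotic to translations: by `log
f'(0)` at `-∞` and by `-log f'(1)` at `+∞`. The conditions on the logarithms of the derivatives say
that the mean step points inwards at both ends. Such maps are uniformly continuous, so their values
on a fine grid `2δℤ` determine them up to a small error.

Let `K` be the union of the translates of the Cantor set by even integers. After rescaling by `δ`,
each of the two maps is approximated by a homeomorphism that sends `K` into itself and is an exact
translation by an even integer near each end (`exists_orderIso_near`, `exists_rescaled_approx`).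
There is room for this because the Cantor set contains any finite number of disjoint, ordered,
affine copies of itself, so several blocks of `K` can be squeezed into one. Errors are of order `δ`,
hence the signs of the drifts survive; suitable shifts keep one map below the identity and the other
above it. The probability `p` is unchanged.

For the new system, a stationary measure is a distribution function fixed by `cdfStep`. It is the
limit of a monotone iteration started at a step function that jumps only at even integers
(`exists_cdfStep_eq`, `exists_isStationaryReal`). Gaps of `K` pull back into gaps of `K`, so the
limit is constant on gaps and its measure lives on the closed null set `K`. Uniqueness is a maximum
principle (`nonpos_of_cdfStep_eq`). A measure with null support is singular, which gives the second
assertion. -/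

/-! ### Stationary measures and distribution functions -/

/-- Stationarity of a measure on the line for the random iteration of two increasing
homeomorphisms. -/
def IsStationaryReal (p : ℝ) (G₀ G₁ : ℝ ≃o ℝ) (ν : Measure ℝ) : Prop :=
  ENNReal.ofReal p • ν.map G₀ + ENNReal.ofReal (1 - p) • ν.map G₁ = ν

/-- The action of the random iteration on distribution functions. -/
def cdfStep (p : ℝ) (G₀ G₁ : ℝ ≃o ℝ) (M : ℝ → ℝ) (x : ℝ) : ℝ :=
  p * M (G₀.symm x) + (1 - p) * M (G₁.symm x)

/-- Half-lines determine a finite measure, and an increasing homeomorphism pulls a half-line back to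
a half-line. -/
theorem isStationaryReal_iff {p : ℝ} (hp : p ∈ Ioo (0 : ℝ) 1) (G₀ G₁ : ℝ ≃o ℝ) (ν : Measure ℝ)
    [IsProbabilityMeasure ν] :
    IsStationaryReal p G₀ G₁ ν ↔
      ∀ x, ProbabilityTheory.cdf ν x = cdfStep p G₀ G₁ (ProbabilityTheory.cdf ν) x := by
  have hp1 : 0 ≤ 1 - p := by linarith [hp.2]
  have key : ∀ x, (ENNReal.ofReal p • ν.map G₀ + ENNReal.ofReal (1 - p) • ν.map G₁) (Iic x)
      = ENNReal.ofReal (cdfStep p G₀ G₁ (ProbabilityTheory.cdf ν) x) := by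
    intro x
    have h0 := ProbabilityTheory.cdf_nonneg ν (G₀.symm x)
    have h1 := ProbabilityTheory.cdf_nonneg ν (G₁.symm x)
    rw [Measure.add_apply, Measure.smul_apply, Measure.smul_apply,
      Measure.map_apply G₀.continuous.measurable measurableSet_Iic,
      Measure.map_apply G₁.continuous.measurable measurableSet_Iic,
      OrderIso.preimage_Iic, OrderIso.preimage_Iic, cdfStep,
      ENNReal.ofReal_add (mul_nonneg hp.1.le h0) (mul_nonneg hp1 h1),
      ENNReal.ofReal_mul hp.1.le, ENNReal.ofReal_mul hp1, ProbabilityTheory.ofReal_cdf,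
      ProbabilityTheory.ofReal_cdf, smul_eq_mul, smul_eq_mul]
  have hnn : ∀ x, 0 ≤ cdfStep p G₀ G₁ (ProbabilityTheory.cdf ν) x := fun x =>
    add_nonneg (mul_nonneg hp.1.le (ProbabilityTheory.cdf_nonneg ν _))
      (mul_nonneg hp1 (ProbabilityTheory.cdf_nonneg ν _))
  constructor
  · intro h x
    have := key x
    rw [h, ← ProbabilityTheory.ofReal_cdf,
      ENNReal.ofReal_eq_ofReal_iff (ProbabilityTheory.cdf_nonneg ν _) (hnn x)] at this
    exact this
  · intro h
    refine (Measure.ext_of_Iic _ _ fun x => ?_).symm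
    rw [key, ← h, ProbabilityTheory.ofReal_cdf]

/-! ### Uniqueness by a maximum principle -/

/-- Iterates of an increasing homeomorphism that moves all points to the right leave every
half-line. -/
theorem exists_iterate_ge (g : ℝ ≃o ℝ) (hg : ∀ x, x < g x) (a b : ℝ) : ∃ n, b ≤ g^[n] a := by
  by_contra! hcon
  have hmono : Monotone fun n => g^[n] a :=
    monotone_nat_of_le_succ fun n => by
      rw [Function.iterate_succ_apply']
      exact (hg _).le
  have hlim := tendsto_atTop_ciSup hmono ⟨b, by rintro _ ⟨n, rfl⟩; exact (hcon n).le⟩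
  have := isFixedPt_of_tendsto_iterate hlim g.continuous.continuousAt
  exact (hg _).ne' this

/-- A positive supremum `s` could only be approached inside a compact interval. From there a fixed
number of steps along the `G₀.symm` branch, which has weight `p ^ n`, leads to the region near `+∞`
where `D < s / 2`; this keeps `D` uniformly below `s`. -/
theorem nonpos_of_cdfStep_eq {p : ℝ} (hp : p ∈ Ioo (0 : ℝ) 1) {G₀ G₁ : ℝ ≃o ℝ}
    (h0 : ∀ x, G₀ x < x) {D : ℝ → ℝ} (hbot : Tendsto D atBot (𝓝 0)) (htop : Tendsto D atTop (𝓝 0))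
    (hbdd : BddAbove (range D)) (hD : ∀ x, D x = cdfStep p G₀ G₁ D x) (x : ℝ) : D x ≤ 0 := by
  by_contra! hx
  set s := ⨆ y, D y with hs
  have hle : ∀ y, D y ≤ s := le_ciSup hbdd
  have hs0 : 0 < s := hx.trans_le (hle x)
  have hg : ∀ y, y < G₀.symm y := fun y => by simpa using h0 (G₀.symm y)
  obtain ⟨a, ha⟩ := eventually_atBot.1 (hbot.eventually (gt_mem_nhds (half_pos hs0)))
  obtain ⟨b, hb⟩ := eventually_atTop.1 (htop.eventually (gt_mem_nhds (half_pos hs0)))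
  obtain ⟨n, hn⟩ := exists_iterate_ge G₀.symm hg a b
  -- The `G₁` branch is bounded crudely by `s` at each step; only the branch that always follows
  -- `G₀.symm` is tracked.
  have hiter : ∀ n y, D y ≤ s - p ^ n * (s - D (G₀.symm^[n] y)) := by
    intro n
    induction n with
    | zero => intro y; simp
    | succ n ih =>
      intro y
      rw [hD y, cdfStep, Function.iterate_succ_apply]
      have h1 := mul_le_mul_of_nonneg_left (ih (G₀.symm y)) hp.1.le
      have h2 := mul_le_mul_of_nonneg_left (hle (G₁.symm y)) (sub_nonneg.2 hp.2.le)
      rw [pow_succ]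
      linarith
  have hpn : 0 < p ^ n := pow_pos hp.1 n
  have hpn1 : p ^ n ≤ 1 := pow_le_one₀ hp.1.le hp.2.le
  have hall : ∀ y, D y ≤ s - p ^ n * (s / 2) := by
    intro y
    rcases le_total y a with hy | hy
    · nlinarith [ha y hy]
    · have h3 : b ≤ G₀.symm^[n] y := hn.trans (G₀.symm.monotone.iterate n hy)
      have := hb _ h3
      have := hiter n y
      nlinarith
  have := ciSup_le hall
  nlinarith

theorem IsStationaryReal.unique {p : ℝ} (hp : p ∈ Ioo (0 : ℝ) 1) {G₀ G₁ : ℝ ≃o ℝ}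
    (h0 : ∀ x, G₀ x < x) {ν ν' : Measure ℝ} [IsProbabilityMeasure ν] [IsProbabilityMeasure ν']
    (hν : IsStationaryReal p G₀ G₁ ν) (hν' : IsStationaryReal p G₀ G₁ ν') : ν = ν' := by
  have main : ∀ (ν ν' : Measure ℝ) [IsProbabilityMeasure ν] [IsProbabilityMeasure ν'],
      IsStationaryReal p G₀ G₁ ν → IsStationaryReal p G₀ G₁ ν' →
      ∀ x, ProbabilityTheory.cdf ν x ≤ ProbabilityTheory.cdf ν' x := by
    intro ν ν' _ _ hν hν' x
    rw [isStationaryReal_iff hp] at hν hν'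
    have := nonpos_of_cdfStep_eq hp h0 (G₁ := G₁)
      (D := fun x => ProbabilityTheory.cdf ν x - ProbabilityTheory.cdf ν' x)
      (by simpa using (ProbabilityTheory.tendsto_cdf_atBot ν).sub (ProbabilityTheory.tendsto_cdf_atBot ν'))
      (by simpa using (ProbabilityTheory.tendsto_cdf_atTop ν).sub (ProbabilityTheory.tendsto_cdf_atTop ν'))
      ⟨1, by
        rintro _ ⟨y, rfl⟩
        linarith [ProbabilityTheory.cdf_le_one ν y, ProbabilityTheory.cdf_nonneg ν' y]⟩
      (fun y => by rw [hν y, hν' y]; simp only [cdfStep]; ring) x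
    linarith
  exact Measure.eq_of_cdf _ _ (StieltjesFunction.ext fun x =>
    le_antisymm (main ν ν' hν hν' x) (main ν' ν hν' hν x))

/-! ### Existence by monotone iteration -/

/-- A distribution function fixed by the random iteration gives a stationary measure, which does
not charge the intervals on which the function is constant. -/
theorem exists_isStationaryReal_of_cdfStep_eq {p : ℝ} (hp : p ∈ Ioo (0 : ℝ) 1) {G₀ G₁ : ℝ ≃o ℝ}
    {M : ℝ → ℝ} (hM : Monotone M) (hbot : Tendsto M atBot (𝓝 0)) (htop : Tendsto M atTop (𝓝 1))
    (hfix : ∀ x, M x = cdfStep p G₀ G₁ M x) :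
    ∃ ν : Measure ℝ, IsProbabilityMeasure ν ∧ IsStationaryReal p G₀ G₁ ν ∧
      ∀ x y, M x = M y → ν (Ioo x y) = 0 := by
  set F := hM.stieltjesFunction with hF
  have hFx : ∀ x, F x = Function.rightLim M x := hM.stieltjesFunction_eq
  have hle : ∀ x, M x ≤ F x := fun x => (hFx x).symm ▸ hM.le_rightLim le_rfl
  have hge : ∀ x y, x < y → F x ≤ M y := fun x y hxy => (hFx x).symm ▸ hM.rightLim_le hxy
  have hFbot : Tendsto F atBot (𝓝 0) :=
    tendsto_of_tendsto_of_tendsto_of_le_of_le hbot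
      (hbot.comp (tendsto_atBot_add_const_right _ 1 tendsto_id)) hle
      fun x => hge x _ (lt_add_one x)
  have hFtop : Tendsto F atTop (𝓝 1) :=
    tendsto_of_tendsto_of_tendsto_of_le_of_le htop
      (htop.comp (tendsto_atTop_add_const_right _ 1 tendsto_id)) hle
      fun x => hge x _ (lt_add_one x)
  have hprob : IsProbabilityMeasure F.measure := F.isProbabilityMeasure hFbot hFtop
  have hcdf : ∀ x, ProbabilityTheory.cdf F.measure x = F x := fun x => by
    rw [ProbabilityTheory.cdf_measure_stieltjesFunction F hFbot hFtop]
  refine ⟨F.measure, hprob, ?_, ?_⟩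
  · rw [isStationaryReal_iff hp]
    intro x
    simp only [cdfStep, hcdf, hFx]
    -- `M` need not be right-continuous. The fixed-point equation passes to right limits because
    -- `G.symm` is strictly increasing and so preserves approach from the right.
    have hsymm : ∀ G : ℝ ≃o ℝ, Tendsto (fun y => M (G.symm y)) (𝓝[>] x)
        (𝓝 (Function.rightLim M (G.symm x))) := fun G =>
      (hM.tendsto_rightLim _).comp (tendsto_nhdsWithin_iff.2
        ⟨G.symm.continuous.continuousAt.mono_left nhdsWithin_le_nhds,
          eventually_nhdsWithin_of_forall fun y hy => G.symm.strictMono hy⟩)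
    refine tendsto_nhds_unique (hM.tendsto_rightLim x) ?_
    exact (((hsymm G₀).const_mul p).add ((hsymm G₁).const_mul (1 - p))).congr
      fun y => (hfix y).symm
  · intro x y hxy
    have h1 : Function.leftLim F y ≤ M y :=
      le_of_tendsto (F.mono.tendsto_leftLim y) (eventually_nhdsWithin_of_forall fun z hz => hge z y hz)
    rw [StieltjesFunction.measure_Ioo, ENNReal.ofReal_eq_zero]
    linarith [hle x]

theorem cdfStep_mono {p : ℝ} (hp : p ∈ Ioo (0 : ℝ) 1) (G₀ G₁ : ℝ ≃o ℝ) {M N : ℝ → ℝ}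
    (h : ∀ x, M x ≤ N x) (x : ℝ) : cdfStep p G₀ G₁ M x ≤ cdfStep p G₀ G₁ N x :=
  add_le_add (mul_le_mul_of_nonneg_left (h _) hp.1.le)
    (mul_le_mul_of_nonneg_left (h _) (sub_nonneg.2 hp.2.le))

/-- A monotone subsolution below a supersolution gives a fixed distribution function in between,
by monotone iteration. -/
theorem exists_cdfStep_eq {p : ℝ} (hp : p ∈ Ioo (0 : ℝ) 1) {G₀ G₁ : ℝ ≃o ℝ} {K : Set ℝ}
    (hK₀ : ∀ x ∈ K, G₀ x ∈ K) (hK₁ : ∀ x ∈ K, G₁ x ∈ K) {φ ψ : ℝ → ℝ} (hφ : Monotone φ)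
    (hsub : ∀ x, φ x ≤ cdfStep p G₀ G₁ φ x) (hsup : ∀ x, cdfStep p G₀ G₁ ψ x ≤ ψ x)
    (hle : ∀ x, φ x ≤ ψ x) (hφK : ∀ x y, x ≤ y → Disjoint (Icc x y) K → φ x = φ y) :
    ∃ M : ℝ → ℝ, Monotone M ∧ (∀ x, φ x ≤ M x) ∧ (∀ x, M x ≤ ψ x) ∧
      (∀ x, M x = cdfStep p G₀ G₁ M x) ∧
      ∀ x y, x ≤ y → Disjoint (Icc x y) K → M x = M y := by
  set T := cdfStep p G₀ G₁ with hT
  have hTmono : ∀ {M N : ℝ → ℝ}, (∀ x, M x ≤ N x) → ∀ x, T M x ≤ T N x :=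
    fun h => cdfStep_mono hp G₀ G₁ h
  have hstep : ∀ n x, T^[n] φ x ≤ T^[n + 1] φ x := by
    intro n
    induction n with
    | zero => exact hsub
    | succ n ih =>
      rw [Function.iterate_succ_apply', Function.iterate_succ_apply']
      exact hTmono ih
  have hupper : ∀ n x, T^[n] φ x ≤ ψ x := by
    intro n
    induction n with
    | zero => exact hle
    | succ n ih =>
      intro x
      rw [Function.iterate_succ_apply']
      exact (hTmono ih x).trans (hsup x)
  have hmono : ∀ n, Monotone (T^[n] φ) := by
    intro n
    induction n with
    | zero => exact hφ
    | succ n ih =>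
      intro x y hxy
      rw [Function.iterate_succ_apply']
      exact add_le_add
        (mul_le_mul_of_nonneg_left (ih (G₀.symm.monotone hxy)) hp.1.le)
        (mul_le_mul_of_nonneg_left (ih (G₁.symm.monotone hxy)) (sub_nonneg.2 hp.2.le))
  -- Forward invariance of `K` means that intervals missing `K` pull back to intervals missing `K`;
  -- this carries constancy on the gaps through the iteration.
  have hdisj : ∀ G : ℝ ≃o ℝ, (∀ x ∈ K, G x ∈ K) → ∀ x y, Disjoint (Icc x y) K →
      Disjoint (Icc (G.symm x) (G.symm y)) K := by
    intro G hG x y h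
    rw [Set.disjoint_left] at h ⊢
    intro z hz hzK
    refine h ⟨?_, ?_⟩ (hG z hzK)
    · exact (G.symm_apply_le).1 hz.1
    · exact (G.le_symm_apply).1 hz.2
  have hconst : ∀ n x y, x ≤ y → Disjoint (Icc x y) K → T^[n] φ x = T^[n] φ y := by
    intro n
    induction n with
    | zero => exact hφK
    | succ n ih =>
      intro x y hxy h
      rw [Function.iterate_succ_apply', hT, cdfStep, cdfStep,
        ih _ _ (G₀.symm.monotone hxy) (hdisj G₀ hK₀ x y h),
        ih _ _ (G₁.symm.monotone hxy) (hdisj G₁ hK₁ x y h)]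
  set M : ℝ → ℝ := fun x => ⨆ n, T^[n] φ x with hMdef
  have hbdd : ∀ x, BddAbove (range fun n => T^[n] φ x) := fun x =>
    ⟨ψ x, by rintro _ ⟨n, rfl⟩; exact hupper n x⟩
  have hlim : ∀ x, Tendsto (fun n => T^[n] φ x) atTop (𝓝 (M x)) := fun x =>
    tendsto_atTop_ciSup (monotone_nat_of_le_succ fun n => hstep n x) (hbdd x)
  refine ⟨M, fun x y hxy => ?_, fun x => ?_, fun x => ?_, fun x => ?_, fun x y hxy h => ?_⟩
  · exact le_of_tendsto_of_tendsto' (hlim x) (hlim y) fun n => hmono n hxy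
  · exact le_ciSup (hbdd x) 0
  · exact ciSup_le fun n => hupper n x
  · refine tendsto_nhds_unique ((tendsto_add_atTop_iff_nat 1).2 (hlim x)) ?_
    simp only [Function.iterate_succ_apply']
    exact ((hlim (G₀.symm x)).const_mul p).add ((hlim (G₁.symm x)).const_mul (1 - p))
  · simp only [hMdef, fun n => hconst n x y hxy h]

/-- A random step with negative mean has an exponential moment at most one. -/
theorem exists_exp_moment_le_one {p u v : ℝ} (h : p * u + (1 - p) * v < 0) :
    ∃ s : ℝ, 0 < s ∧ p * Real.exp (s * u) + (1 - p) * Real.exp (s * v) ≤ 1 := by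
  have hder : HasDerivAt (fun s : ℝ => p * Real.exp (s * u) + (1 - p) * Real.exp (s * v))
      (p * u + (1 - p) * v) 0 := by
    have h1 : ∀ w : ℝ, HasDerivAt (fun s : ℝ => Real.exp (s * w)) w 0 := fun w => by
      simpa using ((hasDerivAt_id (0 : ℝ)).mul_const w).exp
    exact ((h1 u).const_mul p).add ((h1 v).const_mul (1 - p))
  -- The moment function equals `1` at `0` and has negative derivative there, so it is below `1` for
  -- some small positive argument.
  have hev := ((hasDerivWithinAt_iff_tendsto_slope' self_notMem_Ioi).1
    (hder.hasDerivWithinAt (s := Ioi 0))).eventually (gt_mem_nhds h)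
  obtain ⟨t, ht, ht0⟩ := (hev.and self_mem_nhdsWithin).exists
  refine ⟨t, ht0, ?_⟩
  have ht0' : (0 : ℝ) < t := ht0
  rw [slope_def_field, sub_zero, div_neg_iff] at ht
  simp only [zero_mul, Real.exp_zero, mul_one] at ht
  rcases ht with ht | ht <;> linarith

/-- Existence of a stationary measure for maps that are translations near infinity, with the drift
pointing inwards on both sides. The measure lives on any forward invariant set containing the even
integers. -/
theorem exists_isStationaryReal {p : ℝ} (hp : p ∈ Ioo (0 : ℝ) 1) {G₀ G₁ : ℝ ≃o ℝ} {K : Set ℝ}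
    (hK₀ : ∀ x ∈ K, G₀ x ∈ K) (hK₁ : ∀ x ∈ K, G₁ x ∈ K) (hKZ : ∀ m : ℤ, (2 * m : ℝ) ∈ K)
    {α₀ β₀ α₁ β₁ : ℤ}
    (hα₀ : ∀ᶠ x in atBot, G₀ x = x + 2 * α₀) (hα₁ : ∀ᶠ x in atBot, G₁ x = x + 2 * α₁)
    (hβ₀ : ∀ᶠ x in atTop, G₀ x = x + 2 * β₀) (hβ₁ : ∀ᶠ x in atTop, G₁ x = x + 2 * β₁)
    (hα : 0 < p * α₀ + (1 - p) * α₁) (hβ : p * β₀ + (1 - p) * β₁ < 0) :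
    ∃ ν : Measure ℝ, IsProbabilityMeasure ν ∧ IsStationaryReal p G₀ G₁ ν ∧
      ∀ x y, Disjoint (Icc x y) K → ν (Ioo x y) = 0 := by
  have hp1 : 0 ≤ 1 - p := sub_nonneg.2 hp.2.le
  obtain ⟨s, hs, hs1⟩ := exists_exp_moment_le_one hβ
  obtain ⟨t, ht, ht1⟩ := exists_exp_moment_le_one (p := p) (u := -(2 * α₀)) (v := -(2 * α₁))
    (by linarith)
  have htop : ∀ (G : ℝ ≃o ℝ) (β : ℤ), (∀ᶠ x in atTop, G x = x + 2 * β) →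
      ∀ᶠ x in atTop, G.symm x = x - 2 * β := fun G β h => by
    filter_upwards [(tendsto_atTop_add_const_right _ (-(2 * β : ℝ)) tendsto_id).eventually h]
      with x hx
    rw [OrderIso.symm_apply_eq]
    simp only [id] at hx
    rw [← sub_eq_add_neg] at hx
    rw [hx]; ring
  have hbot : ∀ (G : ℝ ≃o ℝ) (β : ℤ), (∀ᶠ x in atBot, G x = x + 2 * β) →
      ∀ᶠ x in atBot, G.symm x = x - 2 * β := fun G β h => by
    filter_upwards [(tendsto_atBot_add_const_right _ (-(2 * β : ℝ)) tendsto_id).eventually h]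
      with x hx
    rw [OrderIso.symm_apply_eq]
    simp only [id] at hx
    rw [← sub_eq_add_neg] at hx
    rw [hx]; ring
  obtain ⟨a, ha⟩ := eventually_atBot.1 ((hbot G₀ α₀ hα₀).and (hbot G₁ α₁ hα₁))
  obtain ⟨b, hb⟩ := eventually_atTop.1 ((htop G₀ β₀ hβ₀).and (htop G₁ β₁ hβ₁))
  obtain ⟨r, hr⟩ : ∃ r : ℤ, max (max a b) 0 ≤ 2 * r :=
    ⟨⌈max (max a b) 0⌉, by
      have := Int.le_ceil (max (max a b) 0)
      have := le_max_right (max a b) 0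
      linarith⟩
  have hra : a ≤ 2 * r := (le_max_left a b).trans ((le_max_left _ _).trans hr)
  have hrb : b ≤ 2 * r := (le_max_right a b).trans ((le_max_left _ _).trans hr)
  -- The floor makes `φ` a step function with jumps only at even integers, which lie in `K`. No such
  -- constraint is needed for `ψ`, which only serves as an upper barrier.
  set φ : ℝ → ℝ := fun x => max 0 (1 - Real.exp (-(s * (⌊x / 2⌋ - r)))) with hφdef
  set ψ : ℝ → ℝ := fun x => min 1 (Real.exp (t * (x - a))) with hψdef
  have hφ0 : ∀ x, 0 ≤ φ x := fun x => le_max_left _ _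
  have hφ1 : ∀ x, φ x ≤ 1 := fun x => max_le zero_le_one (by linarith [Real.exp_pos (-(s * (⌊x / 2⌋ - r)))])
  have hψ0 : ∀ x, 0 ≤ ψ x := fun x => le_min zero_le_one (Real.exp_pos _).le
  have hψ1 : ∀ x, ψ x ≤ 1 := fun x => min_le_left _ _
  have hfloor : ∀ (x : ℝ) (k : ℤ), ⌊(x - 2 * k) / 2⌋ = ⌊x / 2⌋ - k := fun x k => by
    rw [← Int.floor_sub_intCast]; congr 1; ring
  have hφmono : Monotone φ := by
    intro x y hxy
    refine max_le_max le_rfl (sub_le_sub_left (Real.exp_le_exp.2 (neg_le_neg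
      (mul_le_mul_of_nonneg_left (sub_le_sub_right ?_ _) hs.le))) _)
    exact_mod_cast Int.floor_le_floor (by linarith)
  -- Where `φ` is positive, `x` is beyond `b`, both inverse maps are exact translations by even
  -- integers, and the inequality reduces to the exponential moment bound `hs1`.
  have hsub : ∀ x, φ x ≤ cdfStep p G₀ G₁ φ x := by
    intro x
    have hnn : 0 ≤ cdfStep p G₀ G₁ φ x :=
      add_nonneg (mul_nonneg hp.1.le (hφ0 _)) (mul_nonneg hp1 (hφ0 _))
    by_cases hx : ⌊x / 2⌋ ≤ r
    · have : φ x = 0 := by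
        refine max_eq_left ?_
        have hx' : (⌊x / 2⌋ : ℝ) ≤ r := by exact_mod_cast hx
        have : 1 ≤ Real.exp (-(s * (⌊x / 2⌋ - r))) := Real.one_le_exp (by nlinarith)
        linarith
      rwa [this]
    · refine max_le hnn ?_
      have hbx : b ≤ x := by
        have h1 : ((r : ℤ) : ℝ) ≤ ⌊x / 2⌋ := by exact_mod_cast (not_le.1 hx).le
        linarith [Int.floor_le (x / 2)]
      have key : ∀ β : ℤ, 1 - Real.exp (-(s * (⌊x / 2⌋ - r))) * Real.exp (s * β)
          ≤ φ (x - 2 * β) := by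
        intro β
        refine le_trans (le_of_eq ?_) (le_max_right _ _)
        rw [hfloor, ← Real.exp_add]
        push_cast
        ring_nf
      rw [cdfStep, (hb x hbx).1, (hb x hbx).2]
      have e0 := mul_le_mul_of_nonneg_left (key β₀) hp.1.le
      have e1 := mul_le_mul_of_nonneg_left (key β₁) hp1
      have e2 := mul_le_mul_of_nonneg_left hs1 (Real.exp_pos (-(s * (⌊x / 2⌋ - r)))).le
      linarith
  have hsup : ∀ x, cdfStep p G₀ G₁ ψ x ≤ ψ x := by
    intro x
    have hle1 : cdfStep p G₀ G₁ ψ x ≤ 1 := by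
      have e0 := mul_le_mul_of_nonneg_left (hψ1 (G₀.symm x)) hp.1.le
      have e1 := mul_le_mul_of_nonneg_left (hψ1 (G₁.symm x)) hp1
      rw [cdfStep]; linarith
    refine le_min hle1 ?_
    by_cases hx : a ≤ x
    · exact hle1.trans (Real.one_le_exp (mul_nonneg ht.le (sub_nonneg.2 hx)))
    · have key : ∀ α : ℤ, ψ (x - 2 * α) ≤ Real.exp (t * (x - a)) * Real.exp (t * -(2 * α)) := by
        intro α
        refine (min_le_right _ _).trans (le_of_eq ?_)
        rw [← Real.exp_add]
        ring_nf
      rw [cdfStep, (ha x (not_le.1 hx).le).1, (ha x (not_le.1 hx).le).2]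
      have e0 := mul_le_mul_of_nonneg_left (key α₀) hp.1.le
      have e1 := mul_le_mul_of_nonneg_left (key α₁) hp1
      have e2 := mul_le_mul_of_nonneg_left ht1 (Real.exp_pos (t * (x - a))).le
      linarith
  -- The barriers are separated at `a`: `φ` vanishes to the left because `a ≤ 2 * r`, and `ψ = 1` to
  -- the right.
  have hle : ∀ x, φ x ≤ ψ x := by
    intro x
    by_cases hx : a ≤ x
    · have : ψ x = 1 := min_eq_left (Real.one_le_exp (mul_nonneg ht.le (sub_nonneg.2 hx)))
      rw [this]; exact hφ1 x
    · have : φ x = 0 := by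
        refine max_eq_left ?_
        have h1 : (⌊x / 2⌋ : ℝ) ≤ r := by
          linarith [Int.floor_le (x / 2)]
        have : 1 ≤ Real.exp (-(s * (⌊x / 2⌋ - r))) := Real.one_le_exp (by nlinarith)
        linarith
      rw [this]; exact hψ0 x
  have hφK : ∀ x y, x ≤ y → Disjoint (Icc x y) K → φ x = φ y := by
    intro x y hxy h
    suffices hfl : ⌊x / 2⌋ = ⌊y / 2⌋ by simp only [hφdef, hfl]
    -- If the floors differed, the even integer `2 * ⌊y / 2⌋` would be a point of `K` in `[x, y]`.
    refine le_antisymm (Int.floor_le_floor (by linarith)) ?_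
    by_contra! hlt
    refine Set.disjoint_left.1 h (show (2 * ⌊y / 2⌋ : ℝ) ∈ Icc x y from ⟨?_, ?_⟩) (hKZ _)
    · linarith [Int.floor_lt.1 hlt]
    · linarith [Int.floor_le (y / 2)]
  obtain ⟨M, hM, hφM, hMψ, hfix, hMK⟩ := exists_cdfStep_eq hp hK₀ hK₁ hφmono hsub hsup hle hφK
  have hMbot : Tendsto M atBot (𝓝 0) := by
    refine tendsto_of_tendsto_of_tendsto_of_le_of_le tendsto_const_nhds
      (Real.tendsto_exp_atBot.comp ((tendsto_atBot_add_const_right _ (-a) tendsto_id).const_mul_atBot ht))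
      (fun x => (hφ0 x).trans (hφM x)) fun x => ?_
    exact (hMψ x).trans (min_le_right _ _)
  have hMtop : Tendsto M atTop (𝓝 1) := by
    have h1 : Tendsto (fun x : ℝ => (⌊x / 2⌋ : ℝ)) atTop atTop := by
      refine tendsto_atTop_mono (fun x => ?_)
        (tendsto_atTop_add_const_right _ (-1) (tendsto_id.atTop_div_const (r := (2 : ℝ)) two_pos))
      simp only [id]
      linarith [Int.lt_floor_add_one (x / 2)]
    have h2 : Tendsto (fun x : ℝ => 1 - Real.exp (-(s * ((⌊x / 2⌋ : ℝ) - r)))) atTop (𝓝 (1 - 0)) :=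
      (Real.tendsto_exp_neg_atTop_nhds_zero.comp
        ((tendsto_atTop_add_const_right _ (-(r : ℝ)) h1).const_mul_atTop hs)).const_sub 1
    rw [sub_zero] at h2
    exact tendsto_of_tendsto_of_tendsto_of_le_of_le h2 tendsto_const_nhds
      (fun x => (le_max_right _ _).trans (hφM x)) fun x => (hMψ x).trans (hψ1 x)
  obtain ⟨ν, hν, hst, hnull⟩ := exists_isStationaryReal_of_cdfStep_eq hp hM hMbot hMtop hfix
  refine ⟨ν, hν, hst, fun x y hxy => ?_⟩
  rcases le_total x y with h | h
  · exact hnull x y (hMK x y h hxy)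
  · rw [Ioo_eq_empty h.not_gt, measure_empty]

/-! ### The Cantor set and its translates by even integers -/

theorem div_three_mem_cantorSet {x : ℝ} (hx : x ∈ cantorSet) : x / 3 ∈ cantorSet := by
  rw [cantorSet_eq_union_halves]
  exact Or.inl ⟨x, hx, rfl⟩

theorem two_add_div_three_mem_cantorSet {x : ℝ} (hx : x ∈ cantorSet) :
    (2 + x) / 3 ∈ cantorSet := by
  rw [cantorSet_eq_union_halves]
  exact Or.inr ⟨x, hx, rfl⟩

/-- The set is the union of two copies scaled by `1 / 3`, so its finite measure is at most `2 / 3`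
of itself. -/
theorem volume_cantorSet : volume cantorSet = 0 := by
  have hfin : volume cantorSet ≠ ⊤ := isCompact_cantorSet.measure_lt_top.ne
  have h1 : volume ((fun x : ℝ => x / 3) '' cantorSet) = ENNReal.ofReal (1 / 3) * volume cantorSet := by
    have : (fun x : ℝ => x / 3) = fun x => (1 / 3 : ℝ) • x := by ext x; simp; ring
    rw [this, image_smul, Measure.addHaar_smul]
    norm_num
  have h2 : volume ((fun x : ℝ => (2 + x) / 3) '' cantorSet)
      = ENNReal.ofReal (1 / 3) * volume cantorSet := by
    have : (fun x : ℝ => (2 + x) / 3) = (fun x => 2 / 3 + x) ∘ fun x => x / 3 := by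
      ext x; simp; ring
    rw [this, image_comp, image_add_left, measure_preimage_add, h1]
  have h3 : volume cantorSet ≤ ENNReal.ofReal (1 / 3) * volume cantorSet
      + ENNReal.ofReal (1 / 3) * volume cantorSet := by
    conv_lhs => rw [cantorSet_eq_union_halves]
    exact (measure_union_le _ _).trans_eq (by rw [h1, h2])
  rw [← ENNReal.ofReal_toReal hfin, ← ENNReal.ofReal_mul (by norm_num),
    ← ENNReal.ofReal_add (by positivity) (by positivity),
    ENNReal.ofReal_le_ofReal_iff (by positivity)] at h3
  have h4 : (volume cantorSet).toReal = 0 :=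
    le_antisymm (by linarith) ENNReal.toReal_nonneg
  exact ((ENNReal.toReal_eq_zero_iff _).1 h4).resolve_right hfin

/-- The union of the translates of the Cantor set by the even integers. -/
def cantorCopies : Set ℝ := {x | ∃ m : ℤ, ∃ c ∈ cantorSet, x = 2 * m + c}

theorem two_mul_mem_cantorCopies (m : ℤ) : (2 * m : ℝ) ∈ cantorCopies :=
  ⟨m, 0, zero_mem_cantorSet, by simp⟩

theorem volume_cantorCopies : volume cantorCopies = 0 := by
  have : cantorCopies = ⋃ m : ℤ, (fun x => (2 * m : ℝ) + x) '' cantorSet := by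
    ext x
    simp only [cantorCopies, mem_ofPred_eq, mem_iUnion, mem_image, eq_comm]
  rw [this, measure_iUnion_null_iff]
  intro m
  rw [image_add_left, measure_preimage_add, volume_cantorSet]

/-- The set is the preimage of a compact subset of the circle `ℝ / 2ℤ`. -/
theorem isClosed_cantorCopies : IsClosed cantorCopies := by
  have : cantorCopies = (fun x : ℝ => (x : AddCircle (2 : ℝ))) ⁻¹'
      ((fun x : ℝ => (x : AddCircle (2 : ℝ))) '' cantorSet) := by
    ext x
    simp only [cantorCopies, mem_ofPred_eq, mem_preimage, mem_image]
    constructor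
    · rintro ⟨m, c, hc, rfl⟩
      refine ⟨c, hc, ?_⟩
      rw [QuotientAddGroup.eq, AddSubgroup.mem_zmultiples_iff]
      exact ⟨m, by rw [zsmul_eq_mul]; ring⟩
    · rintro ⟨c, hc, h⟩
      rw [QuotientAddGroup.eq, AddSubgroup.mem_zmultiples_iff] at h
      obtain ⟨m, hm⟩ := h
      refine ⟨m, c, hc, ?_⟩
      rw [zsmul_eq_mul] at hm
      linarith
  rw [this]
  exact ((isCompact_cantorSet.image (AddCircle.continuous_mk' 2)).isClosed).preimage
    (AddCircle.continuous_mk' 2)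

/-! ### Piecewise linear homeomorphisms preserving the Cantor copies -/

/-- Piecewise linear interpolation of a sequence indexed by the integers. -/
def interp (a : ℤ → ℝ) (x : ℝ) : ℝ := a ⌊x⌋ + Int.fract x * (a (⌊x⌋ + 1) - a ⌊x⌋)

theorem interp_intCast (a : ℤ → ℝ) (n : ℤ) : interp a n = a n := by simp [interp]

theorem interp_intCast_add (a : ℤ → ℝ) (n : ℤ) {t : ℝ} (h0 : 0 ≤ t) (h1 : t ≤ 1) :
    interp a (n + t) = a n + t * (a (n + 1) - a n) := by
  rcases h1.eq_or_lt with rfl | h1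
  · rw [show (n : ℝ) + 1 = ((n + 1 : ℤ) : ℝ) by push_cast; rfl, interp_intCast]
    ring
  · have hfl : ⌊(n : ℝ) + t⌋ = n := by
      rw [Int.floor_intCast_add, Int.floor_eq_zero_iff.2 ⟨h0, h1⟩, add_zero]
    rw [interp, Int.fract, hfl]
    ring

theorem interp_strictMono {a : ℤ → ℝ} (ha : StrictMono a) : StrictMono (interp a) := by
  intro x y hxy
  have hpos : ∀ n, 0 < a (n + 1) - a n := fun n => sub_pos.2 (ha (lt_add_one n))
  rcases (Int.floor_le_floor hxy.le).eq_or_lt with h | h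
  · simp only [interp, Int.fract, h]
    have := mul_lt_mul_of_pos_right (sub_lt_sub_right hxy (⌊y⌋ : ℝ)) (hpos ⌊y⌋)
    linarith
  · calc interp a x < a (⌊x⌋ + 1) := by
          have := mul_lt_mul_of_pos_right (Int.fract_lt_one x) (hpos ⌊x⌋)
          rw [interp]; linarith
      _ ≤ a ⌊y⌋ := ha.monotone h
      _ ≤ interp a y := by
          have := mul_nonneg (Int.fract_nonneg y) (hpos ⌊y⌋).le
          rw [interp]; linarith

theorem interp_surjective {a : ℤ → ℝ} (ha : StrictMono a) (hbot : Tendsto a atBot atBot)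
    (htop : Tendsto a atTop atTop) : Function.Surjective (interp a) := by
  intro y
  obtain ⟨b, hb⟩ := (htop.eventually (eventually_gt_atTop y)).exists
  obtain ⟨n, hn, hmax⟩ := Int.exists_greatest_of_bdd (P := fun n => a n ≤ y)
    ⟨b, fun z hz => (ha.lt_iff_lt.1 (hz.trans_lt hb)).le⟩
    (hbot.eventually (eventually_le_atBot y)).exists
  have hn1 : y < a (n + 1) := by
    by_contra! h
    have := hmax _ h
    linarith
  have hpos : 0 < a (n + 1) - a n := sub_pos.2 (ha (lt_add_one n))
  refine ⟨n + (y - a n) / (a (n + 1) - a n), ?_⟩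
  rw [interp_intCast_add a n (div_nonneg (sub_nonneg.2 hn) hpos.le)
    ((div_le_one hpos).2 (by linarith)), div_mul_cancel₀ _ hpos.ne']
  ring

/-- Piecewise linear interpolation as an increasing homeomorphism. -/
def interpIso {a : ℤ → ℝ} (ha : StrictMono a) (hbot : Tendsto a atBot atBot)
    (htop : Tendsto a atTop atTop) : ℝ ≃o ℝ :=
  (interp_strictMono ha).orderIsoOfSurjective _ (interp_surjective ha hbot htop)

theorem interpIso_apply {a : ℤ → ℝ} (ha : StrictMono a) (hbot : Tendsto a atBot atBot)
    (htop : Tendsto a atTop atTop) (x : ℝ) : interpIso ha hbot htop x = interp a x := rfl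

theorem interp_eq_add {a : ℤ → ℝ} {x c : ℝ} (h0 : a ⌊x⌋ = ⌊x⌋ + c)
    (h1 : a (⌊x⌋ + 1) = ((⌊x⌋ + 1 : ℤ) : ℝ) + c) : interp a x = x + c := by
  rw [interp, h0, h1]
  push_cast
  linarith [Int.floor_add_fract x]

/-- The Cantor set is preserved by the maps `c ↦ 1 - 3⁻ʲ + 3⁻⁽ʲ⁺¹⁾ c`, whose images of `[0, 1]` are
disjoint and ordered increasingly in `j`. -/
theorem affine_mem_cantorSet (j : ℕ) {c : ℝ} (hc : c ∈ cantorSet) :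
    (1 - (1 / 3) ^ j + (1 / 3) ^ (j + 1) * c : ℝ) ∈ cantorSet := by
  induction j with
  | zero =>
    convert div_three_mem_cantorSet hc using 1
    ring
  | succ j ih =>
    convert two_add_div_three_mem_cantorSet ih using 1
    ring

/-- A nondecreasing map of the integers that is a translation, resp. another one, near the two
infinities extends to an increasing homeomorphism of the line mapping the copies of the Cantor set
into each other. -/
theorem exists_orderIso_of_lattice {S : ℤ → ℤ} (hS : Monotone S) {r₁ r₂ α β : ℤ}
    (hα : ∀ m < r₁, S m = m + α) (hβ : ∀ m, r₂ ≤ m → S m = m + β)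
    (hinj : ∀ m, S m = S (m + 1) → r₁ ≤ m ∧ m + 1 < r₂) :
    ∃ G : ℝ ≃o ℝ, (∀ x ∈ cantorCopies, G x ∈ cantorCopies) ∧
      (∀ᶠ x in atBot, G x = x + 2 * α) ∧ (∀ᶠ x in atTop, G x = x + 2 * β) ∧
      ∀ (m : ℤ) (x : ℝ), 2 * m ≤ x → x ≤ 2 * m + 2 → 2 * S m ≤ G x ∧ G x ≤ 2 * S (m + 1) + 1 := by
  -- The block `[2m, 2m + 1]` goes affinely onto `[2 S m + q m, 2 S m + q m + w m]`. For `r₁ ≤ m <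
  -- r₂` this is the `(m - r₁)`-th of the ordered self-copies of `affine_mem_cantorSet`, so blocks
  -- with the same `S m` have disjoint images in the right order. Outside that range the whole block
  -- is translated.
  set q : ℤ → ℝ := fun m => if r₁ ≤ m ∧ m < r₂ then 1 - (1 / 3) ^ (m - r₁).toNat else 0 with hq
  set w : ℤ → ℝ := fun m => if r₁ ≤ m ∧ m < r₂ then (1 / 3) ^ ((m - r₁).toNat + 1) else 1 with hw
  have hpow : ∀ j : ℕ, (0 : ℝ) < (1 / 3) ^ j := fun j => by positivity
  have hpow1 : ∀ j : ℕ, ((1 : ℝ) / 3) ^ j ≤ 1 := fun j => pow_le_one₀ (by norm_num) (by norm_num)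
  have hq0 : ∀ m, 0 ≤ q m := fun m => by
    simp only [hq]; split_ifs
    · linarith [hpow1 (m - r₁).toNat]
    · exact le_rfl
  have hw0 : ∀ m, 0 < w m := fun m => by
    simp only [hw]; split_ifs
    · exact hpow _
    · exact one_pos
  have hqw : ∀ m, q m + w m ≤ 1 := fun m => by
    simp only [hq, hw]; split_ifs
    · rw [pow_succ]; linarith [hpow (m - r₁).toNat]
    · norm_num
  have hqlt : ∀ m, r₁ ≤ m → m + 1 < r₂ → q m + w m < q (m + 1) := fun m h1 h2 => by
    simp only [hq, hw]
    rw [if_pos ⟨h1, by omega⟩, if_pos ⟨h1, by omega⟩, if_pos ⟨by omega, h2⟩,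
      show (m + 1 - r₁).toNat = (m - r₁).toNat + 1 by omega, pow_succ]
    linarith [hpow (m - r₁).toNat]
  have hmem : ∀ m, ∀ c ∈ cantorSet, q m + w m * c ∈ cantorSet := fun m c hc => by
    simp only [hq, hw]; split_ifs
    · exact affine_mem_cantorSet _ hc
    · simpa using hc
  set a : ℤ → ℝ := fun n => 2 * S (n / 2) + q (n / 2) + (n % 2 : ℤ) * w (n / 2) with ha
  have ha0 : ∀ m, a (2 * m) = 2 * S m + q m := fun m => by
    simp only [ha, show 2 * m / 2 = m by omega, show 2 * m % 2 = 0 by omega]; simp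
  have ha1 : ∀ m, a (2 * m + 1) = 2 * S m + q m + w m := fun m => by
    simp only [ha, show (2 * m + 1) / 2 = m by omega, show (2 * m + 1) % 2 = 1 by omega]; simp
  have hamono : StrictMono a := by
    refine strictMono_int_of_lt_succ fun n => ?_
    obtain ⟨m, rfl | rfl⟩ := Int.even_or_odd' n
    · rw [ha0, ha1]; linarith [hw0 m]
    · rw [ha1, show 2 * m + 1 + 1 = 2 * (m + 1) by ring, ha0]
      -- Equal values of `S` are separated by the order of the self-copies; distinct ones by the gap
      -- of length `1` between blocks.
      rcases (hS (show m ≤ m + 1 by omega)).eq_or_lt with h | h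
      · have := hqlt m (hinj m h).1 (hinj m h).2
        rw [h]; linarith
      · have : (S m : ℝ) + 1 ≤ S (m + 1) := by exact_mod_cast h
        linarith [hqw m, hq0 (m + 1)]
  have hatop : ∀ n, 2 * r₂ ≤ n → a n = n + 2 * β := fun n hn => by
    obtain ⟨m, rfl | rfl⟩ := Int.even_or_odd' n
    · rw [ha0, hβ m (by omega)]
      simp only [hq]
      rw [if_neg (by omega)]; push_cast; ring
    · rw [ha1, hβ m (by omega)]
      simp only [hq, hw]
      rw [if_neg (by omega), if_neg (by omega)]; push_cast; ring
  have habot : ∀ n, n < 2 * r₁ → a n = n + 2 * α := fun n hn => by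
    obtain ⟨m, rfl | rfl⟩ := Int.even_or_odd' n
    · rw [ha0, hα m (by omega)]
      simp only [hq]
      rw [if_neg (by omega)]; push_cast; ring
    · rw [ha1, hα m (by omega)]
      simp only [hq, hw]
      rw [if_neg (by omega), if_neg (by omega)]; push_cast; ring
  have htop : Tendsto a atTop atTop := by
    refine (tendsto_atTop_add_const_right _ (2 * β : ℝ) tendsto_intCast_atTop_atTop).congr' ?_
    filter_upwards [eventually_ge_atTop (2 * r₂)] with n hn
    exact (hatop n hn).symm
  have hbot : Tendsto a atBot atBot := by
    refine (tendsto_atBot_add_const_right _ (2 * α : ℝ)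
      (tendsto_intCast_atBot_iff.2 tendsto_id)).congr' ?_
    filter_upwards [eventually_lt_atBot (2 * r₁)] with n hn
    exact (habot n hn).symm
  refine ⟨interpIso hamono hbot htop, ?_, ?_, ?_, ?_⟩
  · rintro _ ⟨m, c, hc, rfl⟩
    have hc' := cantorSet_subset_unitInterval hc
    refine ⟨S m, q m + w m * c, hmem m c hc, ?_⟩
    rw [interpIso_apply, show (2 * m + c : ℝ) = ((2 * m : ℤ) : ℝ) + c by push_cast; rfl,
      interp_intCast_add a _ hc'.1 hc'.2, ha0, ha1]
    ring
  · filter_upwards [eventually_lt_atBot ((2 * r₁ - 1 : ℤ) : ℝ)] with x hx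
    have := Int.floor_lt.2 hx
    exact interp_eq_add (habot _ (by omega)) (habot _ (by omega))
  · filter_upwards [eventually_ge_atTop ((2 * r₂ : ℤ) : ℝ)] with x hx
    have := Int.le_floor.2 hx
    exact interp_eq_add (hatop _ (by omega)) (hatop _ (by omega))
  · intro m x h1 h2
    have e1 : interp a (2 * m : ℝ) = 2 * S m + q m := by
      rw [← ha0, ← interp_intCast a (2 * m)]; push_cast; rfl
    have e2 : interp a (2 * m + 2 : ℝ) = 2 * S (m + 1) + q (m + 1) := by
      rw [← ha0, ← interp_intCast a (2 * (m + 1))]; push_cast; ring_nf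
    have m1 := (interp_strictMono hamono).monotone h1
    have m2 := (interp_strictMono hamono).monotone h2
    rw [interpIso_apply]
    constructor <;> linarith [hq0 m, hq0 (m + 1), hqw (m + 1), hw0 (m + 1)]

/-- A nondecreasing real sequence that is asymptotic to translations is followed, at a bounded
distance above it, by an increasing homeomorphism that preserves the copies of the Cantor set. -/
theorem exists_orderIso_near {u : ℤ → ℝ} (hu : Monotone u) {l l' : ℝ}
    (hbot : Tendsto (fun m : ℤ => u m - m) atBot (𝓝 l))
    (htop : Tendsto (fun m : ℤ => u m - m) atTop (𝓝 l')) :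
    ∃ (G : ℝ ≃o ℝ) (α β : ℤ), (∀ x ∈ cantorCopies, G x ∈ cantorCopies) ∧
      (∀ᶠ x in atBot, G x = x + 2 * α) ∧ (∀ᶠ x in atTop, G x = x + 2 * β) ∧
      |α - l| ≤ 11 ∧ |β - l'| ≤ 11 ∧
      ∀ (m : ℤ) (x : ℝ), 2 * m ≤ x → x ≤ 2 * m + 2 →
        2 * u m + 4 ≤ G x ∧ G x ≤ 2 * u (m + 1) + 21 := by
  obtain ⟨b₁, hb₁⟩ := eventually_atBot.1 (hbot.eventually (Metric.ball_mem_nhds l one_pos))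
  obtain ⟨b₂, hb₂⟩ := eventually_atTop.1 (htop.eventually (Metric.ball_mem_nhds l' one_pos))
  simp only [Real.dist_eq, abs_lt] at hb₁ hb₂
  set r₁ := min b₁ b₂
  -- The extra `1` makes the estimate at `+∞` available already at `r₂ - 1`, which the junction at
  -- `r₂` needs.
  set r₂ := max b₁ b₂ + 1
  have hr : r₁ < r₂ := by omega
  have h₁ : ∀ m ≤ r₁, -1 < u m - m - l ∧ u m - m - l < 1 := fun m hm => hb₁ m (by omega)
  have h₂ : ∀ m, r₂ ≤ m + 1 → -1 < u m - m - l' ∧ u m - m - l' < 1 := fun m hm => hb₂ m (by omega)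
  -- The offsets `3`, `6`, `8` on the three ranges increase enough to absorb the rounding errors and
  -- the errors below `1` in the asymptotics. Hence `S` jumps strictly at both junctions, and
  -- repeated values occur only in the middle range.
  set α := ⌈l⌉ + 3 with hα
  set β := ⌈l'⌉ + 8 with hβ
  have hα1 : l + 3 ≤ α ∧ α < l + 4 := by
    rw [hα]; push_cast; constructor <;> linarith [Int.le_ceil l, Int.ceil_lt_add_one l]
  have hβ1 : l' + 8 ≤ β ∧ β < l' + 9 := by
    rw [hβ]; push_cast; constructor <;> linarith [Int.le_ceil l', Int.ceil_lt_add_one l']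
  set S : ℤ → ℤ := fun m => if m < r₁ then m + α else if m < r₂ then ⌈u m⌉ + 6 else m + β with hS
  have hSl : ∀ m < r₁, S m = m + α := fun m hm => if_pos hm
  have hSm : ∀ m, r₁ ≤ m → m < r₂ → S m = ⌈u m⌉ + 6 := fun m h h' => by
    simp only [hS]; rw [if_neg (by omega), if_pos h']
  have hSr : ∀ m, r₂ ≤ m → S m = m + β := fun m h => by
    simp only [hS]; rw [if_neg (by omega), if_neg (by omega)]
  have hbd : ∀ m, u m + 2 ≤ S m ∧ S m ≤ u m + 10 := by
    intro m
    rcases lt_or_ge m r₁ with h | h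
    · have := h₁ m h.le
      rw [hSl m h]; push_cast
      constructor <;> linarith
    rcases lt_or_ge m r₂ with h' | h'
    · rw [hSm m h h']; push_cast
      constructor <;> linarith [Int.le_ceil (u m), Int.ceil_lt_add_one (u m)]
    · have := h₂ m (by omega)
      rw [hSr m h']; push_cast
      constructor <;> linarith
  have hstep : ∀ m, S m ≤ S (m + 1) ∧ (S m = S (m + 1) → r₁ ≤ m ∧ m + 1 < r₂) := by
    intro m
    rcases lt_trichotomy (m + 1) r₁ with h | h | h
    · rw [hSl m (by omega), hSl (m + 1) h]; omega
    · have h3 := h₁ (m + 1) h.le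
      have : S m < S (m + 1) := by
        rw [hSl m (by omega), hSm (m + 1) h.ge (by omega)]
        have : ((m + α : ℤ) : ℝ) < ((⌈u (m + 1)⌉ + 6 : ℤ) : ℝ) := by
          push_cast at h3 ⊢
          linarith [Int.le_ceil (u (m + 1))]
        exact_mod_cast this
      omega
    rcases lt_trichotomy (m + 1) r₂ with h' | h' | h'
    · rw [hSm m (by omega) (by omega), hSm (m + 1) (by omega) h']
      have := Int.ceil_le_ceil (hu (show m ≤ m + 1 by omega))
      omega
    · have h3 := h₂ m h'.ge
      have : S m < S (m + 1) := by
        rw [hSm m (by omega) (by omega), hSr (m + 1) h'.ge]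
        have : ((⌈u m⌉ + 6 : ℤ) : ℝ) < ((m + 1 + β : ℤ) : ℝ) := by
          push_cast
          linarith [Int.ceil_lt_add_one (u m)]
        exact_mod_cast this
      omega
    · rw [hSr m (by omega), hSr (m + 1) (by omega)]; omega
  obtain ⟨G, hGK, hGbot, hGtop, hG⟩ := exists_orderIso_of_lattice
    (monotone_int_of_le_succ fun m => (hstep m).1) hSl hSr fun m => (hstep m).2
  refine ⟨G, α, β, hGK, hGbot, hGtop, abs_le.2 ⟨by linarith, by linarith⟩,
    abs_le.2 ⟨by linarith, by linarith⟩, fun m x h1 h2 => ?_⟩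
  have := hG m x h1 h2
  constructor <;> linarith [hbd m, hbd (m + 1)]

/-! ### The coordinate `h` as an order isomorphism onto the line -/

theorem h_of_le {x : OpenI} (hx : (x : ℝ) ≤ 1 / 2) : h x = Real.log x - Real.log (1 / 2) := if_pos hx

theorem h_of_ge {x : OpenI} (hx : 1 / 2 ≤ (x : ℝ)) : h x = Real.log (1 / 2) - Real.log (1 - x) := by
  rcases hx.eq_or_lt with hx | hx
  · rw [h_of_le hx.ge, ← hx]; norm_num
  · exact if_neg hx.not_ge

theorem h_strictMono : StrictMono h := by
  intro x y hxy
  have hxy' : (x : ℝ) < y := hxy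
  have hx0 : (0 : ℝ) < x := x.2.1
  have hy1 : (y : ℝ) < 1 := y.2.2
  rcases le_or_gt (y : ℝ) (1 / 2) with hy | hy
  · rw [h_of_le hy, h_of_le (hxy'.le.trans hy)]
    linarith [Real.log_lt_log hx0 hxy']
  rcases le_or_gt (x : ℝ) (1 / 2) with hx | hx
  · rw [h_of_le hx, h_of_ge hy.le]
    have h1 : Real.log x ≤ Real.log (1 / 2) := Real.log_le_log hx0 hx
    have h2 : Real.log (1 - y) < Real.log (1 / 2) :=
      Real.log_lt_log (by linarith) (by linarith)
    linarith
  · rw [h_of_ge hx.le, h_of_ge hy.le]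
    linarith [Real.log_lt_log (show (0 : ℝ) < 1 - y by linarith)
      (show 1 - (y : ℝ) < 1 - x by linarith)]

theorem h_exp_div_two {y : ℝ} (hy : y ≤ 0) (hm : Real.exp y / 2 ∈ Ioo (0 : ℝ) 1) :
    h ⟨Real.exp y / 2, hm⟩ = y := by
  rw [h_of_le (show Real.exp y / 2 ≤ 1 / 2 by linarith [Real.exp_le_one_iff.2 hy])]
  change Real.log (Real.exp y / 2) - _ = y
  rw [show Real.exp y / 2 = Real.exp y * (1 / 2) by ring,
    Real.log_mul (Real.exp_pos y).ne' (by norm_num), Real.log_exp]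
  ring

theorem h_one_sub_exp_div_two {y : ℝ} (hy : 0 ≤ y) (hm : 1 - Real.exp (-y) / 2 ∈ Ioo (0 : ℝ) 1) :
    h ⟨1 - Real.exp (-y) / 2, hm⟩ = y := by
  rw [h_of_ge (show 1 / 2 ≤ 1 - Real.exp (-y) / 2 by
    linarith [Real.exp_le_one_iff.2 (neg_nonpos.2 hy)])]
  change _ - Real.log (1 - (1 - Real.exp (-y) / 2)) = y
  rw [show 1 - (1 - Real.exp (-y) / 2) = Real.exp (-y) * (1 / 2) by ring,
    Real.log_mul (Real.exp_pos _).ne' (by norm_num), Real.log_exp]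
  ring

theorem exp_div_two_mem {y : ℝ} (hy : y ≤ 0) : Real.exp y / 2 ∈ Ioo (0 : ℝ) 1 :=
  ⟨by positivity, by linarith [Real.exp_le_one_iff.2 hy]⟩

theorem one_sub_exp_div_two_mem {y : ℝ} (hy : 0 ≤ y) : 1 - Real.exp (-y) / 2 ∈ Ioo (0 : ℝ) 1 := by
  have := exp_div_two_mem (neg_nonpos.2 hy)
  exact ⟨by linarith [this.2], by linarith [this.1]⟩

theorem h_surjective : Function.Surjective h := by
  intro y
  rcases le_total y 0 with hy | hy
  · exact ⟨_, h_exp_div_two hy (exp_div_two_mem hy)⟩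
  · exact ⟨_, h_one_sub_exp_div_two hy (one_sub_exp_div_two_mem hy)⟩

/-- The coordinate `h` as an increasing homeomorphism of `(0, 1)` onto the line. -/
def hIso : OpenI ≃o ℝ := h_strictMono.orderIsoOfSurjective h h_surjective

theorem hIso_apply (x : OpenI) : hIso x = h x := rfl

theorem hIso_symm_of_nonpos {y : ℝ} (hy : y ≤ 0) : (hIso.symm y : ℝ) = Real.exp y / 2 := by
  have : hIso.symm y = ⟨Real.exp y / 2, exp_div_two_mem hy⟩ := by
    rw [OrderIso.symm_apply_eq, hIso_apply, h_exp_div_two hy]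
  rw [this]

theorem hIso_symm_of_nonneg {y : ℝ} (hy : 0 ≤ y) : (hIso.symm y : ℝ) = 1 - Real.exp (-y) / 2 := by
  have : hIso.symm y = ⟨1 - Real.exp (-y) / 2, one_sub_exp_div_two_mem hy⟩ := by
    rw [OrderIso.symm_apply_eq, hIso_apply, h_one_sub_exp_div_two hy]
  rw [this]

/-! ### From homeomorphisms of the line to elements of `C(I)` -/

/-- The extension of a self-map of `(0, 1)` to `[0, 1]` fixing the endpoints. -/
def extendFun (e : OpenI → OpenI) (x : I) : I :=
  if hx : (x : ℝ) ∈ Ioo (0 : ℝ) 1 then ⟨e ⟨x, hx⟩, Ioo_subset_Icc_self (e ⟨x, hx⟩).2⟩ else x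

theorem extendFun_of_mem (e : OpenI → OpenI) {x : I} (hx : (x : ℝ) ∈ Ioo (0 : ℝ) 1) :
    extendFun e x = ⟨e ⟨x, hx⟩, Ioo_subset_Icc_self (e ⟨x, hx⟩).2⟩ := dif_pos hx

theorem extendFun_of_notMem (e : OpenI → OpenI) {x : I} (hx : (x : ℝ) ∉ Ioo (0 : ℝ) 1) :
    extendFun e x = x := dif_neg hx

theorem eq_zero_or_one_of_notMem {x : I} (hx : (x : ℝ) ∉ Ioo (0 : ℝ) 1) : x = 0 ∨ x = 1 := by
  by_contra! hne
  exact hx ⟨unitInterval.pos_iff_ne_zero.2 hne.1, unitInterval.lt_one_iff_ne_one.2 hne.2⟩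

theorem extendFun_strictMono {e : OpenI → OpenI} (he : StrictMono e) : StrictMono (extendFun e) := by
  intro x y hxy
  have hxy' : (x : ℝ) < y := hxy
  by_cases hx : (x : ℝ) ∈ Ioo (0 : ℝ) 1 <;> by_cases hy : (y : ℝ) ∈ Ioo (0 : ℝ) 1
  · rw [extendFun_of_mem e hx, extendFun_of_mem e hy]
    exact he (show (⟨x, hx⟩ : OpenI) < ⟨y, hy⟩ from hxy)
  · rw [extendFun_of_mem e hx, extendFun_of_notMem e hy]
    rcases eq_zero_or_one_of_notMem hy with rfl | rfl
    · exact absurd hxy' (not_lt.2 x.2.1)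
    · exact (e ⟨x, hx⟩).2.2
  · rw [extendFun_of_notMem e hx, extendFun_of_mem e hy]
    rcases eq_zero_or_one_of_notMem hx with rfl | rfl
    · exact (e ⟨y, hy⟩).2.1
    · exact absurd hxy' (not_lt.2 y.2.2)
  · rwa [extendFun_of_notMem e hx, extendFun_of_notMem e hy]

theorem extendFun_surjective {e : OpenI → OpenI} (he : Function.Surjective e) :
    Function.Surjective (extendFun e) := by
  intro y
  by_cases hy : (y : ℝ) ∈ Ioo (0 : ℝ) 1
  · obtain ⟨x, hx⟩ := he ⟨y, hy⟩
    refine ⟨⟨x, Ioo_subset_Icc_self x.2⟩, ?_⟩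
    rw [extendFun_of_mem e (x := ⟨x, Ioo_subset_Icc_self x.2⟩) x.2]
    exact Subtype.ext (show (e x : ℝ) = y by rw [hx])
  · exact ⟨y, extendFun_of_notMem e hy⟩

/-- The increasing homeomorphism of `[0, 1]` that reads `G` in the coordinate `h`. -/
def conjHomeo (G : ℝ ≃o ℝ) : I ≃ₜ I :=
  ((extendFun_strictMono (hIso.trans (G.trans hIso.symm)).strictMono).orderIsoOfSurjective _
    (extendFun_surjective (hIso.trans (G.trans hIso.symm)).surjective)).toHomeomorph

theorem conjHomeo_apply (G : ℝ ≃o ℝ) {x : I} (hx : (x : ℝ) ∈ Ioo (0 : ℝ) 1) :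
    (conjHomeo G x : ℝ) = hIso.symm (G (h ⟨x, hx⟩)) :=
  congrArg Subtype.val (extendFun_of_mem (hIso.trans (G.trans hIso.symm)) hx)

/-- `conjHomeo G` as a continuous map. -/
def conjMap (G : ℝ ≃o ℝ) : C(I, I) := ⟨conjHomeo G, (conjHomeo G).continuous⟩

theorem conjMap_zero (G : ℝ ≃o ℝ) : conjMap G 0 = 0 :=
  extendFun_of_notMem _ (by simp)

theorem conjMap_one (G : ℝ ≃o ℝ) : conjMap G 1 = 1 :=
  extendFun_of_notMem _ (by simp)

theorem realExt_conjMap (G : ℝ ≃o ℝ) {x : ℝ} (hx : x ∈ Ioo (0 : ℝ) 1) :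
    realExt (conjMap G) x = hIso.symm (G (h ⟨x, hx⟩)) := by
  rw [realExt, projIcc_of_mem _ (Ioo_subset_Icc_self hx)]
  exact conjHomeo_apply G (x := ⟨x, Ioo_subset_Icc_self hx⟩) hx

theorem realExt_zero {f : C(I, I)} (hf : f 0 = 0) : realExt f 0 = 0 := by
  rw [realExt, projIcc_left]
  exact congrArg Subtype.val hf

theorem realExt_one {f : C(I, I)} (hf : f 1 = 1) : realExt f 1 = 1 := by
  rw [realExt, projIcc_right]
  exact congrArg Subtype.val hf

/-- Near `0` the coordinate is `log (2x)`, so a translation by `α` becomes exact multiplication by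
`exp α`. -/
theorem hasDerivWithinAt_conjMap_zero {G : ℝ ≃o ℝ} {α : ℝ} (hG : ∀ᶠ y in atBot, G y = y + α) :
    HasDerivWithinAt (realExt (conjMap G)) (Real.exp α) (Icc 0 1) 0 := by
  obtain ⟨a, ha⟩ := eventually_atBot.1 hG
  -- Below `c` the map is a translation, and both the point and its image are in the half where `h`
  -- is given by the logarithm of `x`.
  set c := min a (min 0 (-α)) with hc
  have hca : c ≤ a := min_le_left _ _
  have hc0 : c ≤ 0 := (min_le_right _ _).trans (min_le_left _ _)
  have hcα : c ≤ -α := (min_le_right _ _).trans (min_le_right _ _)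
  have h0 : realExt (conjMap G) 0 = Real.exp α * 0 := by
    rw [realExt_zero (conjMap_zero G), mul_zero]
  have hlin : HasDerivWithinAt (fun x => Real.exp α * x) (Real.exp α) (Icc 0 1) 0 := by
    simpa using (hasDerivWithinAt_id (0 : ℝ) (Icc 0 1)).const_mul (Real.exp α)
  refine hlin.congr_of_eventuallyEq ?_ h0
  filter_upwards [self_mem_nhdsWithin,
    nhdsWithin_le_nhds (Iio_mem_nhds (show (0 : ℝ) < Real.exp c / 2 by positivity))] with x hx hxc
  rcases hx.1.eq_or_lt with rfl | hx0
  · exact h0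
  have hxc' : x < Real.exp c / 2 := hxc
  have hx1 : x < 1 := by linarith [(exp_div_two_mem hc0).2]
  have hhx : h ⟨x, hx0, hx1⟩ = Real.log x - Real.log (1 / 2) :=
    h_of_le (show x ≤ 1 / 2 by linarith [Real.exp_le_one_iff.2 hc0])
  have hle : h ⟨x, hx0, hx1⟩ ≤ c := by
    rw [← h_exp_div_two hc0 (exp_div_two_mem hc0)]
    exact h_strictMono.monotone (show x ≤ Real.exp c / 2 from hxc'.le)
  rw [realExt_conjMap G ⟨hx0, hx1⟩, ha _ (hle.trans hca), hIso_symm_of_nonpos (by linarith), hhx,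
    Real.exp_add, Real.exp_sub, Real.exp_log hx0, Real.exp_log (by norm_num)]
  ring

/-- Near `1` the coordinate is `-log (2(1 - x))`, so a translation by `β` multiplies the distance to
`1` by `exp (-β)`. -/
theorem hasDerivWithinAt_conjMap_one {G : ℝ ≃o ℝ} {β : ℝ} (hG : ∀ᶠ y in atTop, G y = y + β) :
    HasDerivWithinAt (realExt (conjMap G)) (Real.exp (-β)) (Icc 0 1) 1 := by
  obtain ⟨a, ha⟩ := eventually_atTop.1 hG
  set c := max a (max 0 (-β)) with hc
  have hca : a ≤ c := le_max_left _ _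
  have hc0 : 0 ≤ c := (le_max_left _ _).trans (le_max_right _ _)
  have hcβ : -β ≤ c := (le_max_right _ _).trans (le_max_right _ _)
  have h1 : realExt (conjMap G) 1 = 1 + Real.exp (-β) * (1 - 1) := by
    rw [realExt_one (conjMap_one G)]; ring
  have hlin : HasDerivWithinAt (fun x => 1 + Real.exp (-β) * (x - 1)) (Real.exp (-β))
      (Icc 0 1) 1 := by
    simpa using (((hasDerivWithinAt_id (1 : ℝ) (Icc 0 1)).sub_const 1).const_mul
      (Real.exp (-β))).const_add 1
  refine hlin.congr_of_eventuallyEq ?_ h1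
  have hpos := Real.exp_pos (-c)
  have hle1 := Real.exp_le_one_iff.2 (neg_nonpos.2 hc0)
  filter_upwards [self_mem_nhdsWithin, nhdsWithin_le_nhds (Ioi_mem_nhds
    (show 1 - Real.exp (-c) / 2 < 1 by linarith))] with x hx hxc
  rcases hx.2.eq_or_lt with rfl | hx1
  · exact h1
  have hxc' : 1 - Real.exp (-c) / 2 < x := hxc
  have hx0 : 0 < x := by linarith
  have hhx : h ⟨x, hx0, hx1⟩ = Real.log (1 / 2) - Real.log (1 - x) :=
    h_of_ge (show 1 / 2 ≤ x by linarith)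
  have hle : c ≤ h ⟨x, hx0, hx1⟩ := by
    rw [← h_one_sub_exp_div_two hc0 (one_sub_exp_div_two_mem hc0)]
    exact h_strictMono.monotone (show 1 - Real.exp (-c) / 2 ≤ x from hxc'.le)
  rw [realExt_conjMap G ⟨hx0, hx1⟩, ha _ (hca.trans hle), hIso_symm_of_nonneg (by linarith), hhx,
    show -(Real.log (1 / 2) - Real.log (1 - x) + β) = Real.log (1 - x) - Real.log (1 / 2) + -β by
      ring, Real.exp_add, Real.exp_sub, Real.exp_log (by linarith), Real.exp_log (by norm_num)]
  ring

theorem derivZero_conjMap {G : ℝ ≃o ℝ} {α : ℝ} (hG : ∀ᶠ y in atBot, G y = y + α) :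
    derivZero (conjMap G) = Real.exp α :=
  (hasDerivWithinAt_conjMap_zero hG).derivWithin (uniqueDiffOn_Icc_zero_one 0 (by simp))

theorem derivOne_conjMap {G : ℝ ≃o ℝ} {β : ℝ} (hG : ∀ᶠ y in atTop, G y = y + β) :
    derivOne (conjMap G) = Real.exp (-β) :=
  (hasDerivWithinAt_conjMap_one hG).derivWithin (uniqueDiffOn_Icc_zero_one 1 (by simp))

theorem isCI_conjMap {G : ℝ ≃o ℝ} {α β : ℝ} (hα : ∀ᶠ y in atBot, G y = y + α)
    (hβ : ∀ᶠ y in atTop, G y = y + β) : IsCI (conjMap G) where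
  surjective := (conjHomeo G).surjective
  map_zero := conjMap_zero G
  map_one := conjMap_one G
  mapsTo x hx := by
    have := conjHomeo_apply G hx
    change (conjHomeo G x : ℝ) ∈ _
    rw [this]
    exact (hIso.symm _).2
  differentiable_zero := (hasDerivWithinAt_conjMap_zero hα).differentiableWithinAt
  differentiable_one := (hasDerivWithinAt_conjMap_one hβ).differentiableWithinAt
  derivZero_pos := by rw [derivZero_conjMap hα]; exact Real.exp_pos _
  derivOne_pos := by rw [derivOne_conjMap hβ]; exact Real.exp_pos _

theorem restrict_conjMap {G : ℝ ≃o ℝ} (hG : IsCI (conjMap G)) (x : OpenI) :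
    CI.restrict ⟨conjMap G, hG⟩ x = hIso.symm (G (h x)) :=
  Subtype.ext (conjHomeo_apply G (x := ⟨x, Ioo_subset_Icc_self x.2⟩) x.2)

/-! ### Asymptotics and uniform continuity of elements of `C(I)` on the line -/

/-- An element of `C(I)` read in the coordinate `h`. -/
def CI.toReal (f : CI) (y : ℝ) : ℝ := h (f.restrict (hIso.symm y))

theorem CI.continuous_toReal (f : CI) : Continuous f.toReal :=
  hIso.continuous.comp (f.continuous_restrict.comp hIso.symm.continuous)

theorem CI.monotone_toReal {f : CI} (hf : IsHomeomorph f.1) : Monotone f.toReal := by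
  have hmono : StrictMono f.1 := by
    refine f.1.continuous.strictMono_of_inj_boundedOrder ?_ hf.injective
    exact (show f.1 0 ≤ f.1 1 by rw [f.2.map_zero, f.2.map_one]; exact zero_le_one)
  intro x y hxy
  exact h_strictMono.monotone (hmono.monotone
    (show (⟨hIso.symm x, _⟩ : I) ≤ ⟨hIso.symm y, _⟩ from hIso.symm.monotone hxy))

theorem CI.realExt_eq (f : CI) (x : OpenI) : realExt f.1 x = f.restrict x := by
  rw [realExt, projIcc_of_mem _ (Ioo_subset_Icc_self x.2)]
  rfl

/-- For very negative `y` the displacement is the logarithm of the difference quotient at `0`. -/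
theorem CI.tendsto_toReal_atBot (f : CI) :
    Tendsto (fun y => f.toReal y - y) atBot (𝓝 (Real.log (derivZero f.1))) := by
  have hx : Tendsto (fun y => (hIso.symm y : ℝ)) atBot (𝓝[Icc 0 1 \ {0}] 0) := by
    refine tendsto_nhdsWithin_iff.2 ⟨?_, Eventually.of_forall fun y =>
      ⟨Ioo_subset_Icc_self (hIso.symm y).2, (hIso.symm y).2.1.ne'⟩⟩
    have := Real.tendsto_exp_atBot.div_const 2
    rw [zero_div] at this
    refine this.congr' ?_
    filter_upwards [eventually_le_atBot 0] with y hy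
    exact (hIso_symm_of_nonpos hy).symm
  have hslope := (hasDerivWithinAt_iff_tendsto_slope.1 f.2.differentiable_zero.hasDerivWithinAt).comp hx
  have hcont : Tendsto (fun y => realExt f.1 (hIso.symm y)) atBot (𝓝 0) := by
    have := f.2.differentiable_zero.continuousWithinAt.tendsto
    rw [realExt_zero f.2.map_zero] at this
    exact this.comp (tendsto_nhdsWithin_mono_right sdiff_subset hx)
  refine (((Real.continuousAt_log f.2.derivZero_pos.ne').tendsto).comp hslope).congr' ?_
  filter_upwards [eventually_le_atBot 0, hcont.eventually (ge_mem_nhds (show (0 : ℝ) < 1 / 2 by norm_num))]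
    with y hy hfy
  rw [f.realExt_eq] at hfy
  have hpos : (0 : ℝ) < f.restrict (hIso.symm y) := (f.restrict (hIso.symm y)).2.1
  have hexp := Real.exp_pos y
  simp only [Function.comp_apply, slope_def_field, realExt_zero f.2.map_zero, sub_zero,
    f.realExt_eq, CI.toReal]
  rw [h_of_le hfy, Real.log_div hpos.ne' (hIso.symm y).2.1.ne', hIso_symm_of_nonpos hy,
    show Real.exp y / 2 = Real.exp y * (1 / 2) by ring,
    Real.log_mul hexp.ne' (by norm_num), Real.log_exp]
  ring

theorem CI.tendsto_toReal_atTop (f : CI) :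
    Tendsto (fun y => f.toReal y - y) atTop (𝓝 (-Real.log (derivOne f.1))) := by
  have hx : Tendsto (fun y => (hIso.symm y : ℝ)) atTop (𝓝[Icc 0 1 \ {1}] 1) := by
    refine tendsto_nhdsWithin_iff.2 ⟨?_, Eventually.of_forall fun y =>
      ⟨Ioo_subset_Icc_self (hIso.symm y).2, (hIso.symm y).2.2.ne⟩⟩
    have := (Real.tendsto_exp_neg_atTop_nhds_zero.div_const 2).const_sub 1
    rw [zero_div, sub_zero] at this
    refine this.congr' ?_
    filter_upwards [eventually_ge_atTop 0] with y hy
    exact (hIso_symm_of_nonneg hy).symm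
  have hslope := (hasDerivWithinAt_iff_tendsto_slope.1 f.2.differentiable_one.hasDerivWithinAt).comp hx
  have hcont : Tendsto (fun y => realExt f.1 (hIso.symm y)) atTop (𝓝 1) := by
    have := f.2.differentiable_one.continuousWithinAt.tendsto
    rw [realExt_one f.2.map_one] at this
    exact this.comp (tendsto_nhdsWithin_mono_right sdiff_subset hx)
  refine (((Real.continuousAt_log f.2.derivOne_pos.ne').tendsto).comp hslope).neg.congr' ?_
  filter_upwards [eventually_ge_atTop 0, hcont.eventually (le_mem_nhds (show (1 / 2 : ℝ) < 1 by norm_num))]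
    with y hy hfy
  rw [f.realExt_eq] at hfy
  have hlt : (f.restrict (hIso.symm y) : ℝ) < 1 := (f.restrict (hIso.symm y)).2.2
  have hexp := Real.exp_pos (-y)
  simp only [Function.comp_apply, slope_def_field, realExt_one f.2.map_one, f.realExt_eq,
    CI.toReal]
  rw [h_of_ge hfy, ← neg_div_neg_eq, neg_sub, neg_sub, Real.log_div (by linarith)
    (by linarith [(hIso.symm y).2.2]), hIso_symm_of_nonneg hy,
    show 1 - (1 - Real.exp (-y) / 2) = Real.exp (-y) * (1 / 2) by ring,
    Real.log_mul hexp.ne' (by norm_num), Real.log_exp]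
  ring

/-- Subtracting the identity and a Lipschitz ramp from `l` to `l'` leaves a continuous function that
vanishes at both infinities. -/
theorem uniformContinuous_of_tendsto_sub {F : ℝ → ℝ} (hF : Continuous F) {l l' : ℝ}
    (hbot : Tendsto (fun y => F y - y) atBot (𝓝 l))
    (htop : Tendsto (fun y => F y - y) atTop (𝓝 l')) : UniformContinuous F := by
  set c : ℝ → ℝ := fun y => l + (projIcc (0 : ℝ) 1 zero_le_one y : ℝ) * (l' - l) with hc
  have hcl : LipschitzWith 1 fun y : ℝ => (projIcc (0 : ℝ) 1 zero_le_one y : ℝ) :=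
    LipschitzWith.projIcc zero_le_one
  have hcu : UniformContinuous c :=
    uniformContinuous_const.add (hcl.uniformContinuous.mul_const' (l' - l))
  have hrest : UniformContinuous fun y => F y - y - c y := by
    refine Continuous.uniformContinuous_of_tendsto_cocompact (x := 0)
      ((hF.sub continuous_id).sub hcu.continuous) ?_
    rw [cocompact_eq_atBot_atTop, tendsto_sup]
    constructor
    · have : Tendsto (fun y => F y - y - l) atBot (𝓝 0) := by simpa using hbot.sub_const l
      refine this.congr' ?_
      filter_upwards [eventually_le_atBot 0] with y hy
      simp [hc, projIcc_of_le_left _ hy]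
    · have : Tendsto (fun y => F y - y - l') atTop (𝓝 0) := by simpa using htop.sub_const l'
      refine this.congr' ?_
      filter_upwards [eventually_ge_atTop 1] with y hy
      simp [hc, projIcc_of_right_le _ hy]
  have := (hrest.add hcu).add uniformContinuous_id
  convert this using 2 with y
  simp

/-! ### Approximation at scale `δ` -/

/-- Rescaling the line. -/
def scaleIso {δ : ℝ} (hδ : 0 < δ) : ℝ ≃o ℝ := OrderIso.mulLeft₀ δ hδ

/-- An increasing homeomorphism after rescaling of the line. -/
def rescale {δ : ℝ} (hδ : 0 < δ) (G : ℝ ≃o ℝ) : ℝ ≃o ℝ :=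
  (scaleIso hδ).symm.trans (G.trans (scaleIso hδ))

theorem rescale_apply {δ : ℝ} (hδ : 0 < δ) (G : ℝ ≃o ℝ) (y : ℝ) :
    rescale hδ G y = δ * G (δ⁻¹ * y) := rfl

theorem rescale_eventually_atBot {δ : ℝ} (hδ : 0 < δ) {G : ℝ ≃o ℝ} {c : ℝ}
    (hG : ∀ᶠ x in atBot, G x = x + c) : ∀ᶠ y in atBot, rescale hδ G y = y + δ * c := by
  filter_upwards [(tendsto_id.const_mul_atBot (inv_pos.2 hδ)).eventually hG] with y hy
  rw [rescale_apply, show G (δ⁻¹ * y) = δ⁻¹ * y + c from hy]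
  field_simp

theorem rescale_eventually_atTop {δ : ℝ} (hδ : 0 < δ) {G : ℝ ≃o ℝ} {c : ℝ}
    (hG : ∀ᶠ x in atTop, G x = x + c) : ∀ᶠ y in atTop, rescale hδ G y = y + δ * c := by
  filter_upwards [(tendsto_id.const_mul_atTop (inv_pos.2 hδ)).eventually hG] with y hy
  rw [rescale_apply, show G (δ⁻¹ * y) = δ⁻¹ * y + c from hy]
  field_simp

/-- Approximation of a map asymptotic to translations, at small scale and with a prescribed
shift `k`, by homeomorphisms that preserve the copies of the Cantor set. -/
theorem exists_rescaled_approx {F : ℝ → ℝ} (hmono : Monotone F) {l l' : ℝ}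
    (hbot : Tendsto (fun y => F y - y) atBot (𝓝 l))
    (htop : Tendsto (fun y => F y - y) atTop (𝓝 l')) {δ ε : ℝ} (hδ : 0 < δ)
    (hε : ∀ y, F (y + 2 * δ) - F y ≤ ε) {k : ℝ} (hk : |k| ≤ 12) :
    ∃ (G : ℝ ≃o ℝ) (α β : ℤ), (∀ x ∈ cantorCopies, G x ∈ cantorCopies) ∧
      (∀ᶠ x in atBot, G x = x + 2 * α) ∧ (∀ᶠ x in atTop, G x = x + 2 * β) ∧
      |δ * (2 * α) - l| ≤ 46 * δ ∧ |δ * (2 * β) - l'| ≤ 46 * δ ∧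
      (∀ y, |rescale hδ G y - F y| ≤ ε + 46 * δ) ∧
      ∀ y, ∃ z, z ≤ y ∧ y ≤ z + 2 * δ ∧
        F z + δ * (2 * k + 4) ≤ rescale hδ G y ∧
        rescale hδ G y ≤ F (z + 2 * δ) + δ * (2 * k + 21) := by
  have h2δ : 0 < 2 * δ := by linarith
  set u : ℤ → ℝ := fun m => F (2 * δ * m) / (2 * δ) + k with hu
  have humono : Monotone u := fun m n hmn => by
    have : (m : ℝ) ≤ n := by exact_mod_cast hmn
    exact add_le_add_left (div_le_div_of_nonneg_right
      (hmono (mul_le_mul_of_nonneg_left this h2δ.le)) h2δ.le) _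
  have hdiff : ∀ m : ℤ, (F (2 * δ * m) - 2 * δ * m) / (2 * δ) + k = u m - m := fun m => by
    simp only [hu]; field_simp; ring
  have hubot : Tendsto (fun m : ℤ => u m - m) atBot (𝓝 (l / (2 * δ) + k)) :=
    (((hbot.comp ((tendsto_intCast_atBot_iff.2 tendsto_id).const_mul_atBot h2δ)).div_const
      (2 * δ)).add_const k).congr hdiff
  have hutop : Tendsto (fun m : ℤ => u m - m) atTop (𝓝 (l' / (2 * δ) + k)) :=
    (((htop.comp (tendsto_intCast_atTop_atTop.const_mul_atTop h2δ)).div_const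
      (2 * δ)).add_const k).congr hdiff
  obtain ⟨G, α, β, hGK, hGbot, hGtop, hα, hβ, hG⟩ := exists_orderIso_near humono hubot hutop
  rw [abs_le] at hk
  -- The constant is `46 = 2 * (11 + 12)`: the error of `exists_orderIso_near` plus the bound on the
  -- shift, times the grid step `2δ`.
  have hslope : ∀ (l : ℝ) (α : ℤ), |(α : ℝ) - (l / (2 * δ) + k)| ≤ 11 →
      |δ * (2 * α) - l| ≤ 46 * δ := fun l α h => by
    have e : l = 2 * δ * (l / (2 * δ)) := by field_simp
    rw [abs_le] at h ⊢
    set c := l / (2 * δ)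
    rw [e]
    constructor <;> nlinarith
  have hnear : ∀ y, ∃ z, z ≤ y ∧ y ≤ z + 2 * δ ∧
      F z + δ * (2 * k + 4) ≤ rescale hδ G y ∧
      rescale hδ G y ≤ F (z + 2 * δ) + δ * (2 * k + 21) := fun y => by
    set m := ⌊y / (2 * δ)⌋ with hm
    have h1 : 2 * δ * m ≤ y := by
      have := Int.floor_le (y / (2 * δ))
      rwa [le_div_iff₀ h2δ, mul_comm] at this
    have h2 : y ≤ 2 * δ * m + 2 * δ := by
      have := (Int.lt_floor_add_one (y / (2 * δ))).le
      rw [div_le_iff₀ h2δ] at this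
      linarith
    have e : y = δ * (δ⁻¹ * y) := by field_simp
    have hb := hG m (δ⁻¹ * y) (le_of_mul_le_mul_left (by linarith) hδ)
      (le_of_mul_le_mul_left (by linarith) hδ)
    have e1 : δ * (2 * u m) = F (2 * δ * m) + δ * (2 * k) := by
      simp only [hu]; field_simp
    have e2 : δ * (2 * u (m + 1)) = F (2 * δ * m + 2 * δ) + δ * (2 * k) := by
      simp only [hu]; push_cast; rw [mul_add (2 * δ), mul_one]; field_simp
    refine ⟨2 * δ * m, h1, h2, ?_, ?_⟩ <;> rw [rescale_apply]
    · linarith [mul_le_mul_of_nonneg_left hb.1 hδ.le]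
    · linarith [mul_le_mul_of_nonneg_left hb.2 hδ.le]
  refine ⟨G, α, β, hGK, hGbot, hGtop, hslope l α hα, hslope l' β hβ, fun y => ?_, hnear⟩
  obtain ⟨z, hz1, hz2, hz3, hz4⟩ := hnear y
  have := hmono hz1
  have := hmono hz2
  have := hε z
  rw [abs_le]
  constructor <;> nlinarith

/-! ### Transfer of stationary measures to the interval -/

/-- Stationary measures on the line and on `(0, 1)` correspond to each other under a conjugacy. -/
theorem RDS.isStationary_map {f : RDS} {G₀ G₁ : ℝ ≃o ℝ} {e : ℝ ≃o OpenI}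
    (h₀ : ∀ x, f.1.1.restrict (e x) = e (G₀ x)) (h₁ : ∀ x, f.1.2.1.restrict (e x) = e (G₁ x))
    {ν : Measure ℝ} (hν : IsStationaryReal (f.1.2.2 : ℝ) G₀ G₁ ν) : f.IsStationary (ν.map e) := by
  have he := e.continuous.measurable
  rw [RDS.IsStationary, RDS.markov, Measure.map_map f.1.1.continuous_restrict.measurable he,
    Measure.map_map f.1.2.1.continuous_restrict.measurable he,
    show f.1.1.restrict ∘ e = e ∘ G₀ from funext h₀,
    show f.1.2.1.restrict ∘ e = e ∘ G₁ from funext h₁,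
    ← Measure.map_map he G₀.continuous.measurable, ← Measure.map_map he G₁.continuous.measurable,
    ← Measure.map_smul (μ := ν.map G₀), ← Measure.map_smul (μ := ν.map G₁),
    ← Measure.map_add _ _ he]
  exact congrArg _ hν

theorem RDS.IsStationary.map_symm {f : RDS} {G₀ G₁ : ℝ ≃o ℝ} {e : ℝ ≃o OpenI}
    (h₀ : ∀ x, f.1.1.restrict (e x) = e (G₀ x)) (h₁ : ∀ x, f.1.2.1.restrict (e x) = e (G₁ x))
    {μ : Measure OpenI} (hμ : f.IsStationary μ) :
    IsStationaryReal (f.1.2.2 : ℝ) G₀ G₁ (μ.map e.symm) := by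
  have he := e.symm.continuous.measurable
  rw [IsStationaryReal, Measure.map_map G₀.continuous.measurable he,
    Measure.map_map G₁.continuous.measurable he,
    show G₀ ∘ e.symm = e.symm ∘ f.1.1.restrict from funext fun x => by
      simp only [Function.comp_apply]; rw [OrderIso.eq_symm_apply, ← h₀, e.apply_symm_apply],
    show G₁ ∘ e.symm = e.symm ∘ f.1.2.1.restrict from funext fun x => by
      simp only [Function.comp_apply]; rw [OrderIso.eq_symm_apply, ← h₁, e.apply_symm_apply],
    ← Measure.map_map he f.1.1.continuous_restrict.measurable,
    ← Measure.map_map he f.1.2.1.continuous_restrict.measurable,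
    ← Measure.map_smul (μ := μ.map f.1.1.restrict), ← Measure.map_smul (μ := μ.map f.1.2.1.restrict),
    ← Measure.map_add _ _ he]
  exact congrArg _ hμ

/-- The chart is given by one of two differentiable formulas on each half-line, and differentiable
maps of the line preserve null sets. -/
theorem leb_image_scale_eq_zero {δ : ℝ} (hδ : 0 < δ) {K : Set ℝ} (hK : volume K = 0) :
    leb ((scaleIso hδ).trans hIso.symm '' K) = 0 := by
  rw [leb_apply, ← image_comp]
  have hsub : (Subtype.val ∘ (scaleIso hδ).trans hIso.symm) '' K ⊆
      (fun y => Real.exp (δ * y) / 2) '' K ∪ (fun y => 1 - Real.exp (-(δ * y)) / 2) '' K := by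
    rintro _ ⟨y, hy, rfl⟩
    rcases le_total (δ * y) 0 with h | h
    · exact Or.inl ⟨y, hy, (hIso_symm_of_nonpos h).symm⟩
    · exact Or.inr ⟨y, hy, (hIso_symm_of_nonneg h).symm⟩
  refine measure_mono_null hsub (measure_union_null ?_ ?_)
  · exact addHaar_image_eq_zero_of_differentiableOn_of_addHaar_eq_zero _ (by fun_prop) hK
  · exact addHaar_image_eq_zero_of_differentiableOn_of_addHaar_eq_zero _ (by fun_prop) hK

/-- A system conjugate, at some scale, to homeomorphisms of the line preserving the copies of the
Cantor set has a unique stationary measure, whose support is null. -/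
theorem RDS.exists_isTheStationaryMeasure_leb_support {f : RDS} {δ : ℝ} (hδ : 0 < δ)
    {G₀ G₁ : ℝ ≃o ℝ} {α₀ β₀ α₁ β₁ : ℤ}
    (h₀ : ∀ x, f.1.1.restrict x = hIso.symm (rescale hδ G₀ (h x)))
    (h₁ : ∀ x, f.1.2.1.restrict x = hIso.symm (rescale hδ G₁ (h x)))
    (hK₀ : ∀ x ∈ cantorCopies, G₀ x ∈ cantorCopies) (hK₁ : ∀ x ∈ cantorCopies, G₁ x ∈ cantorCopies)
    (hα₀ : ∀ᶠ x in atBot, G₀ x = x + 2 * α₀) (hα₁ : ∀ᶠ x in atBot, G₁ x = x + 2 * α₁)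
    (hβ₀ : ∀ᶠ x in atTop, G₀ x = x + 2 * β₀) (hβ₁ : ∀ᶠ x in atTop, G₁ x = x + 2 * β₁)
    (hα : 0 < (f.1.2.2 : ℝ) * α₀ + (1 - (f.1.2.2 : ℝ)) * α₁)
    (hβ : (f.1.2.2 : ℝ) * β₀ + (1 - (f.1.2.2 : ℝ)) * β₁ < 0) :
    ∃ μ, f.IsTheStationaryMeasure μ ∧ leb μ.support = 0 := by
  have hp := f.2.prob_mem
  obtain ⟨ν, hν, hst, hnull⟩ := exists_isStationaryReal hp hK₀ hK₁ two_mul_mem_cantorCopies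
    hα₀ hα₁ hβ₀ hβ₁ hα hβ
  set e : ℝ ≃o OpenI := (scaleIso hδ).trans hIso.symm with he
  have hconj : ∀ G : ℝ ≃o ℝ, ∀ x, hIso.symm (rescale hδ G (h (e x))) = e (G x) := fun G x => by
    have : h (e x) = scaleIso hδ x := hIso.apply_symm_apply _
    rw [this]
    simp [he, rescale]
  have hc₀ : ∀ x, f.1.1.restrict (e x) = e (G₀ x) := fun x => by rw [h₀, hconj]
  have hc₁ : ∀ x, f.1.2.1.restrict (e x) = e (G₁ x) := fun x => by rw [h₁, hconj]
  have hbelow : ∀ x, G₀ x < x := fun x => by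
    have := f.2.below (e x)
    rwa [hc₀, e.lt_iff_lt] at this
  have hem := e.continuous.measurable
  have hesm := e.symm.continuous.measurable
  refine ⟨ν.map e, ⟨Measure.isProbabilityMeasure_map hem.aemeasurable,
    RDS.isStationary_map hc₀ hc₁ hst, fun μ hμ hμst => ?_⟩, ?_⟩
  · have : IsProbabilityMeasure (μ.map e.symm) :=
      Measure.isProbabilityMeasure_map hesm.aemeasurable
    have heq := (hμst.map_symm hc₀ hc₁).unique hp hbelow hst
    rw [← heq, Measure.map_map hem hesm,
      show (e ∘ e.symm : OpenI → OpenI) = id from funext e.apply_symm_apply, Measure.map_id]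
  · refine measure_mono_null (fun x hx => ?_) (leb_image_scale_eq_zero hδ volume_cantorCopies)
    by_contra hxK
    rw [← he] at hxK
    have hy : e.symm x ∈ cantorCopiesᶜ := fun hy => hxK ⟨_, hy, e.apply_symm_apply x⟩
    -- Since the Cantor copies are closed, a point off them has an interval neighbourhood inside a
    -- gap, which `ν` does not charge.
    obtain ⟨a, b, -, hab, hsub⟩ := exists_Icc_mem_subset_of_mem_nhds
      (isClosed_cantorCopies.isOpen_compl.mem_nhds hy)
    have hnhds : e.symm ⁻¹' Ioo a b ∈ 𝓝 x :=
      e.symm.continuous.continuousAt.preimage_mem_nhds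
        (interior_Icc (a := a) ▸ interior_mem_nhds.2 hab)
    refine ((Measure.mem_support_iff_forall x).1 hx _ hnhds).ne' ?_
    rw [Measure.map_apply hem (hesm measurableSet_Ioo), ← preimage_comp,
      show (e.symm ∘ e : ℝ → ℝ) = id from funext e.symm_apply_apply, preimage_id]
    exact hnull a b (disjoint_left.2 fun z hz => hsub hz)

theorem mutuallySingular_of_leb_support_eq_zero {μ : Measure OpenI} (hμ : leb μ.support = 0) :
    μ ⟂ₘ leb :=
  ⟨μ.supportᶜ, Measure.isOpen_compl_support.measurableSet, Measure.measure_compl_support,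
    by rwa [compl_compl]⟩

/-! ### Density -/

theorem CI.edist_conjMap_le {f : CI} {G : ℝ ≃o ℝ} (hG : IsCI (conjMap G)) {ε : ℝ}
    (h : ∀ y, |G y - f.toReal y| ≤ ε) : edist f ⟨conjMap G, hG⟩ ≤ ENNReal.ofReal ε := by
  refine iSup_le fun x => ENNReal.ofReal_le_ofReal ?_
  have h1 : f.toReal (RandomInterval.h x) = RandomInterval.h (f.restrict x) :=
    congrArg (fun z => RandomInterval.h (f.restrict z)) (hIso.symm_apply_apply x)
  have h2 : RandomInterval.h (CI.restrict ⟨conjMap G, hG⟩ x) = G (RandomInterval.h x) := by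
    rw [restrict_conjMap]
    exact hIso.apply_symm_apply _
  rw [h2, ← h1, abs_sub_comm]
  exact h _

theorem exists_small_step {F : ℝ → ℝ} (hF : UniformContinuous F) {ε : ℝ} (hε : 0 < ε) :
    ∃ η > 0, ∀ δ, 0 < δ → δ ≤ η → ∀ y, F (y + 2 * δ) - F y ≤ ε := by
  obtain ⟨η, hη, h⟩ := Metric.uniformContinuous_iff.1 hF ε hε
  refine ⟨η / 3, by positivity, fun δ hδ hδη y => ?_⟩
  have := h (a := y + 2 * δ) (b := y) (by
    rw [Real.dist_eq, add_sub_cancel_left, abs_of_pos (by linarith)]; linarith)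
  rw [Real.dist_eq] at this
  exact (le_abs_self _).trans this.le

theorem dense_leb_support_eq_zero :
    Dense {f : RDS | ∃ μ, f.IsTheStationaryMeasure μ ∧ leb μ.support = 0} := by
  intro f
  rw [EMetric.mem_closure_iff]
  intro r hr
  obtain ⟨ε, hε, hεr⟩ := ENNReal.lt_iff_exists_nnreal_btwn.1 hr
  have hε0 : (0 : ℝ) < ε := by exact_mod_cast hε
  have hp := f.2.prob_mem
  set p : ℝ := (f.1.2.2 : ℝ) with hpdef
  have hp1 : 0 < 1 - p := sub_pos.2 hp.2
  have hF₀bot := f.1.1.tendsto_toReal_atBot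
  have hF₀top := f.1.1.tendsto_toReal_atTop
  have hF₁bot := f.1.2.1.tendsto_toReal_atBot
  have hF₁top := f.1.2.1.tendsto_toReal_atTop
  have hdrift₀ := f.2.lyapunov_zero
  have hdrift₁ := f.2.lyapunov_one
  set l₀ := Real.log (derivZero f.1.1.1)
  set l₁ := Real.log (derivZero f.1.2.1.1)
  set l₀' := Real.log (derivOne f.1.1.1)
  set l₁' := Real.log (derivOne f.1.2.1.1)
  obtain ⟨η₀, hη₀, hη₀F⟩ := exists_small_step (uniformContinuous_of_tendsto_sub
    f.1.1.continuous_toReal hF₀bot hF₀top) (half_pos hε0)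
  obtain ⟨η₁, hη₁, hη₁F⟩ := exists_small_step (uniformContinuous_of_tendsto_sub
    f.1.2.1.continuous_toReal hF₁bot hF₁top) (half_pos hε0)
  -- Each asymptotic displacement moves by at most `46 * δ`, hence so do their `p`-averages; with
  -- both drifts larger than this, the signs persist.
  obtain ⟨δ, hδ, hδη₀, hδη₁, hδε, hδd, hδd'⟩ : ∃ δ > 0, δ ≤ η₀ ∧ δ ≤ η₁ ∧ 46 * δ ≤ ε / 2 ∧
      46 * δ < p * l₀ + (1 - p) * l₁ ∧ 46 * δ < p * l₀' + (1 - p) * l₁' := by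
    have hev : ∀ c : ℝ, 0 < c → ∀ᶠ δ : ℝ in 𝓝[>] 0, 46 * δ < c := fun c hc => by
      filter_upwards [Ioo_mem_nhdsGT (show 0 < c / 46 by positivity)] with δ hδ
      linarith [hδ.2]
    have hall := (eventually_mem_nhdsWithin (a := (0 : ℝ)) (s := Ioi 0)).and ((hev (46 * η₀) (by positivity)).and
      ((hev (46 * η₁) (by positivity)).and ((hev (ε / 2) (by positivity)).and
        ((hev _ hdrift₀).and (hev _ hdrift₁)))))
    obtain ⟨δ, h0, h1, h2, h3, h4, h5⟩ := hall.exists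
    exact ⟨δ, h0, by linarith, by linarith, h3.le, h4, h5⟩
  -- The shift `k = -12` turns the upper bound into `F (z + 2δ) - 3δ < z - δ < y`, so the
  -- approximation stays below the identity.
  obtain ⟨G₀, α₀, β₀, hK₀, hα₀, hβ₀, hα₀l, hβ₀l, hG₀F, hG₀⟩ := exists_rescaled_approx
    (CI.monotone_toReal f.2.homeo_fst) hF₀bot hF₀top hδ (hη₀F δ hδ hδη₀) (k := -12) (by norm_num)
  -- Here `k = 0` suffices: the lower bound `F z + 4δ > z + 4δ` already exceeds `y ≤ z + 2δ`.
  obtain ⟨G₁, α₁, β₁, hK₁, hα₁, hβ₁, hα₁l, hβ₁l, hG₁F, hG₁⟩ := exists_rescaled_approx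
    (CI.monotone_toReal f.2.homeo_snd) hF₁bot hF₁top hδ (hη₁F δ hδ hδη₁) (k := 0) (by norm_num)
  have hα₀' := rescale_eventually_atBot hδ hα₀
  have hα₁' := rescale_eventually_atBot hδ hα₁
  have hβ₀' := rescale_eventually_atTop hδ hβ₀
  have hβ₁' := rescale_eventually_atTop hδ hβ₁
  rw [abs_le] at hα₀l hα₁l hβ₀l hβ₁l
  have hdα : 0 < p * (δ * (2 * α₀)) + (1 - p) * (δ * (2 * α₁)) := by
    have e0 := mul_le_mul_of_nonneg_left hα₀l.1 hp.1.le
    have e1 := mul_le_mul_of_nonneg_left hα₁l.1 hp1.le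
    linarith
  have hdβ : p * (δ * (2 * β₀)) + (1 - p) * (δ * (2 * β₁)) < 0 := by
    have e0 := mul_le_mul_of_nonneg_left hβ₀l.2 hp.1.le
    have e1 := mul_le_mul_of_nonneg_left hβ₁l.2 hp1.le
    linarith
  have hCI₀ := isCI_conjMap hα₀' hβ₀'
  have hCI₁ := isCI_conjMap hα₁' hβ₁'
  have hbelow : ∀ y, rescale hδ G₀ y < y := fun y => by
    obtain ⟨z, hz1, hz2, -, hz4⟩ := hG₀ y
    have : f.1.1.toReal (z + 2 * δ) < z + 2 * δ := by
      have := h_strictMono (f.2.below (hIso.symm (z + 2 * δ)))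
      exact this.trans_eq (hIso.apply_symm_apply _)
    linarith
  have habove : ∀ y, y < rescale hδ G₁ y := fun y => by
    obtain ⟨z, hz1, hz2, hz3, -⟩ := hG₁ y
    have : z < f.1.2.1.toReal z := by
      have := h_strictMono (f.2.above (hIso.symm z))
      exact (hIso.apply_symm_apply _).symm.trans_lt this
    linarith
  have hRDS : IsRDS (⟨conjMap (rescale hδ G₀), hCI₀⟩, ⟨conjMap (rescale hδ G₁), hCI₁⟩, f.1.2.2) :=
    { homeo_fst := (conjHomeo _).isHomeomorph
      homeo_snd := (conjHomeo _).isHomeomorph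
      below := fun x => by
        rw [restrict_conjMap, OrderIso.symm_apply_lt]
        exact hbelow _
      above := fun x => by
        rw [restrict_conjMap, OrderIso.lt_symm_apply]
        exact habove _
      prob_mem := hp
      lyapunov_zero := by
        change 0 < p * Real.log (derivZero (conjMap _)) + (1 - p) * Real.log (derivZero (conjMap _))
        rwa [derivZero_conjMap hα₀', derivZero_conjMap hα₁', Real.log_exp, Real.log_exp]
      lyapunov_one := by
        change 0 < p * Real.log (derivOne (conjMap _)) + (1 - p) * Real.log (derivOne (conjMap _))
        rw [derivOne_conjMap hβ₀', derivOne_conjMap hβ₁', Real.log_exp, Real.log_exp]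
        linarith }
  refine ⟨⟨_, hRDS⟩, RDS.exists_isTheStationaryMeasure_leb_support hδ
    (restrict_conjMap hCI₀) (restrict_conjMap hCI₁) hK₀ hK₁ hα₀ hα₁ hβ₀ hβ₁ ?_ ?_, ?_⟩
  · change 0 < p * α₀ + (1 - p) * α₁
    refine pos_of_mul_pos_right (a := 2 * δ) ?_ (by positivity)
    linarith
  · change p * β₀ + (1 - p) * β₁ < 0
    refine neg_of_mul_neg_right (a := 2 * δ) ?_ (by positivity)
    linarith
  · refine lt_of_le_of_lt ?_ hεr
    rw [← ENNReal.ofReal_coe_nnreal]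
    refine max_le (CI.edist_conjMap_le hCI₀ fun y => (hG₀F y).trans (by linarith))
      (max_le (CI.edist_conjMap_le hCI₁ fun y => (hG₁F y).trans (by linarith)) ?_)
    exact (edist_self f.1.2.2).trans_le zero_le

end RandomInterval

end

theorem mainTheorem3 :
    Dense {f : RandomInterval.RDS | ∃ μ : MeasureTheory.Measure RandomInterval.OpenI,
      f.IsTheStationaryMeasure μ ∧ RandomInterval.leb μ.support = 0} ∧
    Dense {f : RandomInterval.RDS | ∃ μ : MeasureTheory.Measure RandomInterval.OpenI,
      f.IsTheStationaryMeasure μ ∧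
        MeasureTheory.Measure.MutuallySingular μ RandomInterval.leb} :=
  ⟨RandomInterval.dense_leb_support_eq_zero,
    RandomInterval.dense_leb_support_eq_zero.mono <| by
      rintro f ⟨μ, hμ, hsupp⟩
      exact ⟨μ, hμ, RandomInterval.mutuallySingular_of_leb_support_eq_zero hsupp⟩⟩
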